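/- Let $n\ge 4$, let $q$ be a prime power, and let $Q$ be a hyperbolic quadratic form on $V=\mathbb F_q^{2n}$ (nondegenerate, with totally singular subspaces of dimension $n$, called generators). The generators fall into two classes, two generators $N_1,N_2$ being in the same class if and only if $\dim(N_1\cap N_2)\equiv n \pmod 2$. The oriflamme complex of the hyperbolic quadric $Q=0$ has the types $1,\dots,n-2,n,n'$: its elements of type $i\le n-2$ are the totally singular subspaces of (vector space) dimension $i$, and its elements of type $n$ and $n'$ are the generators of the first and of the second class. Incidence is symmetrized inclusion, except that generators of types $n$ and $n'$ are incident if they meet in dimension $n-1$. A flag is a set of pairwise incident elements; its type $J$ is the set of the types of its elements. Let $G$ be the group of type-preserving isometries of $Q$, acting on the maximal flags, with its $BN$-pair: $B$ is the stabilizer of the maximal flag $\langle e_1\rangle,\dots,\langle e_1,\dots,e_{n-2}\rangle,\langle e_1,\dots,e_{n-1},e_n\rangle,\langle e_1,\dots,e_{n-1},e_{-n}\rangle$ of a polar frame $\{e_{\pm1},\dots,e_{\pm n}\}$ (singular points, $e_i$ being orthogonal to all of them except $e_{-i}$), and the Weyl group $W$ of type $D_n$ acts on the indices of the frame by the permutations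 generated by $s_i=(i,i+1)(-i,-(i+1))$, $1\le i\le n-1$, and $u=ts_{n-1}t$, where $t=(-n,n)$. The generators $s_1,\dots,s_{n-2},u,s_{n-1}$ correspond to the types $1,\dots,n-2,n,n'$. Let $w_0$ be the longest element of $W$; it acts on the types by conjugation of these generators. Two maximal flags $gB,hB$ are opposite if $Bg^{-1}hB=Bw_0B$; two flags of types $J$ and $K$ are opposite if $J^{w_0}=K$ and they can be extended to opposite maximal flags. For a type $J$ with $J^{w_0}=J$, an EKR-set of flags of type $J$ is a set of flags of type $J$ no two of which are opposite. Theorem. Let $J=J^{w_0}$ and let $C$ be one of the following sets of flags of type $J$: (i) if $1\in J$: all flags of type $J$ whose element of type $1$ (the point) lies in a fixed generator (of either class); (ii) if $n$ is even and $n\in J$ (resp. $n'\in J$): all flags of type $J$ whose element of type $n$ (resp. $n'$) passes through a fixed point of the quadric; (iii) if $n=4$ and $n\in J$ (resp. $n'\in J$): all flags of type $J$ whose element of type $n$ (resp. $n'$) is incident with a fixed element of type $n'$ (resp. $n$). Then $C$ is an EKR-set of flags, and $$|C|=\frac{v}{1+q^{n-1}},$$ where $v$ is the number of all flags of type $J$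 (this is the general upper bound for the size of an EKR-set of flags of type $J$). -/

import Mathlib

namespace Oriflamme

open Module

/-- The types of elements of the oriflamme complex of a hyperbolic quadric of rank `n`, i.e. the
nodes of the Dynkin diagram `D_n`: `sub i` is the type `i + 1` in `{1, …, n - 2}`, `gen` is the
type `n` and `gen'` is the type `n'`. -/
inductive Node (n : ℕ) : Type
  | sub (i : Fin (n - 2)) : Node n
  | gen : Node n
  | gen' : Node n

/-! ### The Weyl group of type `D_n`

The set `{-n, …, -1, 1, …, n}` is `Fin n × ℤˣ`; the pair `(i, ε)` stands for `ε (i + 1)`. -/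

/-- The involution `s_{k+1} = (k+1, k+2)(-(k+1), -(k+2))`, for `k + 1 < n`. -/
def sGen (n k : ℕ) : Equiv.Perm (Fin n × ℤˣ) :=
  if h : k + 1 < n then
    Equiv.prodCongr (Equiv.swap ⟨k, by omega⟩ ⟨k + 1, h⟩) (Equiv.refl ℤˣ)
  else 1

/-- The transposition `t = (-n, n)`. -/
def tGen (n : ℕ) : Equiv.Perm (Fin n × ℤˣ) :=
  if h : 0 < n then Equiv.swap (⟨n - 1, by omega⟩, 1) (⟨n - 1, by omega⟩, -1) else 1

/-- The Coxeter generator attached to a node: `s_1, …, s_{n-2}` for the types `1, …, n - 2`,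
`u = t s_{n-1} t` for the type `n`, and `s_{n-1}` for the type `n'`. In the standard maximal flag
(see `frameSpace`) the generator of a node moves the element of that type and no other one. -/
def simpleReflection {n : ℕ} : Node n → Equiv.Perm (Fin n × ℤˣ)
  | .sub i => sGen n i
  | .gen => tGen n * sGen n (n - 2) * tGen n
  | .gen' => sGen n (n - 2)

/-- The Weyl group of type `D_n`. -/
def weylGroup (n : ℕ) : Subgroup (Equiv.Perm (Fin n × ℤˣ)) :=
  Subgroup.closure (Set.range (simpleReflection (n := n)))

/-- The length of an element of the Weyl group: the least length of a word in the generators. -/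
noncomputable def length {n : ℕ} (w : Equiv.Perm (Fin n × ℤˣ)) : ℕ :=
  sInf {k : ℕ | ∃ l : List (Node n), l.length = k ∧ (l.map simpleReflection).prod = w}

/-- `w` is the longest element of the Weyl group. -/
def IsLongest {n : ℕ} (w : Equiv.Perm (Fin n × ℤˣ)) : Prop :=
  w ∈ weylGroup n ∧ ∀ v ∈ weylGroup n, length v ≤ length w

/-- `K = J ^ w`: conjugation by `w` maps the generators of the nodes in `J` onto those of the
nodes in `K`. -/
def ConjType {n : ℕ} (w : Equiv.Perm (Fin n × ℤˣ)) (J K : Set (Node n)) : Prop :=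
  (fun s => w⁻¹ * s * w) '' (simpleReflection '' J) = simpleReflection '' K

/-! ### The hyperbolic quadric and its oriflamme complex -/

variable {F V : Type*} [Field F] [AddCommGroup V] [Module F V]

/-- Totally singular subspaces, i.e. the subspaces contained in the quadric `Q = 0`. -/
def TotallySingular (Q : QuadraticForm F V) (U : Submodule F V) : Prop :=
  ∀ x ∈ U, Q x = 0

/-- `Q` defines a hyperbolic quadric of rank `n`: it is a nondegenerate quadratic form in
dimension `2n` with a totally singular subspace of dimension `n`. -/
def IsHyperbolic (n : ℕ) (Q : QuadraticForm F V) : Prop :=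
  finrank F V = 2 * n ∧ (QuadraticMap.polarBilin Q).SeparatingLeft ∧
    ∃ M : Submodule F V, TotallySingular Q M ∧ finrank F M = n

/-- The points of the quadric. -/
def IsPoint (Q : QuadraticForm F V) (P : Submodule F V) : Prop :=
  TotallySingular Q P ∧ finrank F P = 1

/-- The generators of the quadric of rank `n`. -/
def IsGenerator (n : ℕ) (Q : QuadraticForm F V) (M : Submodule F V) : Prop :=
  TotallySingular Q M ∧ finrank F M = n

/-- Polar frames `e_{-n}, …, e_{-1}, e_1, …, e_n`, given by vectors spanning the points: singular
points such that `e_i` is collinear (orthogonal) to all of them except `e_{-i}`. The vectors are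
nonzero, since `e_i` is not orthogonal to `e_{-i}`. -/
def IsPolarFrame {n : ℕ} (Q : QuadraticForm F V) (e : Fin n × ℤˣ → V) : Prop :=
  (∀ a, Q (e a) = 0) ∧
    ∀ a b, QuadraticMap.polar Q (e a) (e b) = 0 ↔ b ≠ (a.1, -a.2)

/-- The members of the maximal flag `⟨e_1⟩, ⟨e_1, e_2⟩, …, ⟨e_1, …, e_{n-2}⟩` together with
`⟨e_1, …, e_{n-1}, e_n⟩` (type `n`) and `⟨e_1, …, e_{n-1}, e_{-n}⟩` (type `n'`). -/
def frameSpace {n : ℕ} (e : Fin n × ℤˣ → V) : Node n → Submodule F V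
  | .sub i => Submodule.span F (e '' {a | a.1.val ≤ i.val ∧ a.2 = 1})
  | .gen => Submodule.span F (e '' {a | a.2 = 1})
  | .gen' => Submodule.span F (e '' {a | a.2 = if a.1.val + 1 = n then -1 else 1})

/-- `U` is an element of type `j`. The class of generators called type `n` is the one that contains
`⟨e_1, …, e_n⟩`; two generators are in the same class when the dimension of their intersection is
congruent to `n` modulo `2`. -/
def HasType {n : ℕ} (Q : QuadraticForm F V) (e : Fin n × ℤˣ → V) :
    Node n → Submodule F V → Prop
  | .sub i, U => TotallySingular Q U ∧ finrank F U = i.val + 1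
  | .gen, U => IsGenerator n Q U ∧
      finrank F (U ⊓ frameSpace e .gen : Submodule F V) ≡ n [MOD 2]
  | .gen', U => IsGenerator n Q U ∧
      ¬ finrank F (U ⊓ frameSpace e .gen : Submodule F V) ≡ n [MOD 2]

/-- Incidence of an element `U` of type `j` and an element `W` of type `k`: symmetrized inclusion,
and elements of types `n` and `n'` are incident when they meet in dimension `n - 1`. -/
def Incident {n : ℕ} (j k : Node n) (U W : Submodule F V) : Prop :=
  U ≤ W ∨ W ≤ U ∨
    (((j = .gen ∧ k = .gen') ∨ (j = .gen' ∧ k = .gen)) ∧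
      finrank F (U ⊓ W : Submodule F V) + 1 = n)

/-- The flags of type `J`: one element of each type in `J`, any two of them incident (distinct
elements of one type are never incident). -/
@[ext]
structure Flag {n : ℕ} (Q : QuadraticForm F V) (e : Fin n × ℤˣ → V) (J : Set (Node n)) where
  elt : (j : Node n) → j ∈ J → Submodule F V
  hasType : ∀ j hj, HasType Q e j (elt j hj)
  incident : ∀ j hj k hk, Incident j k (elt j hj) (elt k hk)

/-- The group acting on the oriflamme complex: the linear isometries of `Q` that preserve types
(up to scalars). -/
def isometryGroup {n : ℕ} (Q : QuadraticForm F V) (e : Fin n × ℤˣ → V) :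
    Subgroup (V ≃ₗ[F] V) where
  carrier := {g | (∀ x, Q (g x) = Q x) ∧
    ∀ (j : Node n) (U : Submodule F V),
      HasType Q e j (U.map (g : V →ₗ[F] V)) ↔ HasType Q e j U}
  one_mem' := by
    refine ⟨fun x => rfl, fun j U => ?_⟩
    have : U.map ((1 : V ≃ₗ[F] V) : V →ₗ[F] V) = U := Submodule.map_id U
    rw [this]
  mul_mem' := by
    rintro g h ⟨hg, hg'⟩ ⟨hh, hh'⟩
    refine ⟨fun x => (hg (h x)).trans (hh x), fun j U => ?_⟩
    have : U.map ((g * h : V ≃ₗ[F] V) : V →ₗ[F] V)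
        = (U.map (h : V →ₗ[F] V)).map (g : V →ₗ[F] V) :=
      Submodule.map_comp (h : V →ₗ[F] V) (g : V →ₗ[F] V) U
    rw [this, hg', hh']
  inv_mem' := by
    rintro g ⟨hg, hg'⟩
    refine ⟨fun x => ?_, fun j U => ?_⟩
    · rw [← hg (g⁻¹ x)]
      exact congrArg Q (g.apply_symm_apply x)
    · rw [← hg' j]
      have : (U.map ((g⁻¹ : V ≃ₗ[F] V) : V →ₗ[F] V)).map (g : V →ₗ[F] V) = U := by
        rw [← Submodule.map_comp]
        convert Submodule.map_id U
        ext x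
        exact g.apply_symm_apply x
      rw [this]

/-- The relation `R_w` on maximal flags, `{(gB, gwB) : g ∈ G}`, where the coset `gB` is the image
under `g` of the standard flag of the frame `e`, and `wB` is the flag of the frame `i ↦ e_{w(i)}`. -/
def relPos {n : ℕ} (Q : QuadraticForm F V) (e : Fin n × ℤˣ → V) (w : Equiv.Perm (Fin n × ℤˣ))
    (x y : Flag Q e Set.univ) : Prop :=
  ∃ g ∈ isometryGroup Q e,
    (∀ j hj, x.elt j hj = (frameSpace e j).map (g : V →ₗ[F] V)) ∧
    (∀ j hj, y.elt j hj = (frameSpace (e ∘ w) j).map (g : V →ₗ[F] V))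

/-- The maximal flag `c` extends the flag `x`. -/
def Extends {n : ℕ} {Q : QuadraticForm F V} {e : Fin n × ℤˣ → V} {J : Set (Node n)}
    (c : Flag Q e Set.univ) (x : Flag Q e J) : Prop :=
  ∀ j hj, c.elt j (Set.mem_univ j) = x.elt j hj

/-- Opposite flags of types `J` and `K`, for the longest element `w₀`. -/
def Opposite {n : ℕ} {Q : QuadraticForm F V} {e : Fin n × ℤˣ → V}
    (w₀ : Equiv.Perm (Fin n × ℤˣ)) {J K : Set (Node n)}
    (x : Flag Q e J) (y : Flag Q e K) : Prop :=
  ConjType w₀ J K ∧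
    ∃ c d : Flag Q e Set.univ, Extends c x ∧ Extends d y ∧ relPos Q e w₀ c d

/-- EKR-sets of flags: no two flags in `C` are opposite. -/
def IsEKR {n : ℕ} {Q : QuadraticForm F V} {e : Fin n × ℤˣ → V}
    (w₀ : Equiv.Perm (Fin n × ℤˣ)) {J : Set (Node n)} (C : Set (Flag Q e J)) : Prop :=
  ∀ x ∈ C, ∀ y ∈ C, ¬ Opposite w₀ x y

/-- `|C| = v / (1 + q^{n-1})`, where `v` is the number of all flags of type `J`. -/
def MeetsBound {n : ℕ} {Q : QuadraticForm F V} {e : Fin n × ℤˣ → V} {J : Set (Node n)}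
    (C : Set (Flag Q e J)) : Prop :=
  (C.ncard : ℚ) = (Nat.card (Flag Q e J) : ℚ) / (1 + (Nat.card F : ℚ) ^ (n - 1))

/-- The type `1`. -/
def pointNode (n : ℕ) (hn : 4 ≤ n) : Node n := .sub ⟨0, by omega⟩

end Oriflamme

/-!
Let `p` be a singular point. The flags whose element of a given type passes through `p` are equally
many for all `p`, because the type-preserving isometries are transitive on singular points. Double
counting incidences with the points of a totally singular subspace `M` therefore determines the sum
over all flags `x` of `q ^ dim (xⱼ ∩ M)`. In each of the three constructions `dim (xⱼ ∩ M)` takes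
only two values, one inside and one outside of `C`, so this sum gives `|C|`; in (iii) the values
are `3` and `1`, because the parity of `dim (xⱼ ∩ M)` is determined by the classes.

The longest element maps `i` to `-i` for `i < n`, and also for `i = n` if `n` is even. So the points
of opposite flags are not perpendicular, and for even `n` their elements of type `n` or `n'` are
disjoint: two points of one generator are not opposite, generators through a common point are not
opposite, and neither are generators meeting a fixed one in more than half of its dimension.
-/

namespace Oriflamme

open Module QuadraticMap

section Perp

variable {F V : Type*} [Field F] [AddCommGroup V] [Module F V] {Q : QuadraticForm F V} {n : ℕ}

/-- The orthogonal space `U^⊥` of `U` with respect to the polar form of `Q`. -/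
def perp (Q : QuadraticForm F V) (U : Submodule F V) : Submodule F V :=
  LinearMap.BilinForm.orthogonal (polarBilin Q) U

theorem mem_perp {U : Submodule F V} {x : V} : x ∈ perp Q U ↔ ∀ u ∈ U, polar Q u x = 0 := Iff.rfl

theorem mem_perp_span {s : Set V} {x : V} :
    x ∈ perp Q (Submodule.span F s) ↔ ∀ y ∈ s, polar Q y x = 0 :=
  Submodule.span_le (p := LinearMap.ker ((polarBilin Q).flip x))

theorem mem_perp_span_singleton {x y : V} : x ∈ perp Q (F ∙ y) ↔ polar Q y x = 0 := by
  simp only [mem_perp_span, Set.mem_singleton_iff, forall_eq]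

theorem perp_anti {U W : Submodule F V} (h : U ≤ W) : perp Q W ≤ perp Q U :=
  LinearMap.BilinForm.orthogonal_le h

theorem perp_sup (U W : Submodule F V) : perp Q (U ⊔ W) = perp Q U ⊓ perp Q W := by
  refine le_antisymm (le_inf (perp_anti le_sup_left) (perp_anti le_sup_right)) ?_
  rintro x ⟨hxU, hxW⟩
  refine mem_perp.2 fun y hy => ?_
  obtain ⟨u, hu, w, hw, rfl⟩ := Submodule.mem_sup.1 hy
  rw [polar_add_left, mem_perp.1 hxU u hu, mem_perp.1 hxW w hw, add_zero]

theorem isRefl_polarBilin (Q : QuadraticForm F V) : (polarBilin Q).IsRefl := fun x y h =>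
  (polar_comm Q y x).trans h

theorem TotallySingular.mono {U W : Submodule F V} (hW : TotallySingular Q W) (h : U ≤ W) :
    TotallySingular Q U := fun x hx => hW x (h hx)

theorem TotallySingular.polar_eq_zero {U : Submodule F V} (hU : TotallySingular Q U) {x y : V}
    (hx : x ∈ U) (hy : y ∈ U) : polar Q x y = 0 := by
  rw [polar, hU _ hx, hU _ hy, hU _ (U.add_mem hx hy), sub_zero, sub_zero]

theorem TotallySingular.le_perp {U : Submodule F V} (hU : TotallySingular Q U) : U ≤ perp Q U :=
  fun _ hx => mem_perp.2 fun _ hu => hU.polar_eq_zero hu hx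

theorem TotallySingular.sup {U W : Submodule F V} (hU : TotallySingular Q U)
    (hW : TotallySingular Q W) (h : U ≤ perp Q W) : TotallySingular Q (U ⊔ W) := fun x hx => by
  obtain ⟨u, hu, w, hw, rfl⟩ := Submodule.mem_sup.1 hx
  rw [QuadraticMap.map_add Q, hU u hu, hW w hw, polar_comm, mem_perp.1 (h hu) w hw, add_zero,
    add_zero]

theorem totallySingular_span {s : Set V} (h_sing : ∀ x ∈ s, Q x = 0)
    (h_polar : ∀ x ∈ s, ∀ y ∈ s, polar Q x y = 0) : TotallySingular Q (Submodule.span F s) := by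
  have h_perp : Submodule.span F s ≤ perp Q (Submodule.span F s) :=
    Submodule.span_le.2 fun y hy => mem_perp_span.2 fun x hx => h_polar x hx y hy
  intro x hx
  induction hx using Submodule.span_induction with
  | mem x hx => exact h_sing x hx
  | zero => exact QuadraticMap.map_zero Q
  | add x y hx hy hQx hQy =>
    rw [QuadraticMap.map_add Q, hQx, hQy, mem_perp.1 (h_perp hy) x hx, add_zero, add_zero]
  | smul a x _ hQx => rw [QuadraticMap.map_smul, hQx, smul_zero]

theorem polar_self_eq_zero {x : V} (hx : Q x = 0) : polar Q x x = 0 := by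
  rw [polar_self, hx, smul_zero]

theorem totallySingular_span_singleton {x : V} (hx : Q x = 0) : TotallySingular Q (F ∙ x) :=
  totallySingular_span (by simpa using hx) (by simpa using polar_self_eq_zero hx)

/-- Two generators are adjacent if they meet in a common hyperplane. -/
def Adjacent (n : ℕ) (U W : Submodule F V) : Prop :=
  finrank F (U ⊓ W : Submodule F V) + 1 = n

theorem Adjacent.symm {U W : Submodule F V} (h : Adjacent n U W) : Adjacent n W U := by
  rwa [Adjacent, inf_comm]

namespace IsHyperbolic

theorem nondegenerate (hQ : IsHyperbolic n Q) : (polarBilin Q).Nondegenerate :=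
  (isRefl_polarBilin Q).nondegenerate_iff_separatingLeft.2 hQ.2.1

theorem finiteDimensional (hQ : IsHyperbolic n Q) (hn : 0 < n) : FiniteDimensional F V :=
  FiniteDimensional.of_finrank_pos (by rw [hQ.1]; omega)

variable [FiniteDimensional F V]

theorem perp_perp (hQ : IsHyperbolic n Q) (U : Submodule F V) : perp Q (perp Q U) = U :=
  LinearMap.BilinForm.orthogonal_orthogonal hQ.nondegenerate (isRefl_polarBilin Q) U

theorem finrank_perp_add (hQ : IsHyperbolic n Q) (U : Submodule F V) :
    finrank F (perp Q U) + finrank F U = 2 * n := by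
  rw [perp, LinearMap.BilinForm.finrank_orthogonal hQ.nondegenerate, hQ.1]
  have := hQ.1 ▸ Submodule.finrank_le U
  omega

theorem perp_inf (hQ : IsHyperbolic n Q) (U W : Submodule F V) :
    perp Q (U ⊓ W) = perp Q U ⊔ perp Q W := by
  rw [← hQ.perp_perp (perp Q U ⊔ perp Q W), perp_sup, hQ.perp_perp, hQ.perp_perp]

end IsHyperbolic

end Perp

section Generators

variable {F V : Type*} [Field F] [AddCommGroup V] [Module F V] [FiniteDimensional F V]
  {Q : QuadraticForm F V} {n : ℕ} {E M U W : Submodule F V}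

theorem TotallySingular.finrank_le (hU : TotallySingular Q U) (hQ : IsHyperbolic n Q) :
    finrank F U ≤ n := by
  have := Submodule.finrank_mono hU.le_perp
  have := hQ.finrank_perp_add U
  omega

theorem IsGenerator.perp_eq (hU : IsGenerator n Q U) (hQ : IsHyperbolic n Q) : perp Q U = U := by
  refine (Submodule.eq_of_le_of_finrank_le hU.1.le_perp ?_).symm
  have := hQ.finrank_perp_add U
  rw [hU.2] at this ⊢
  omega

theorem IsGenerator.le_perp_of_le (hU : IsGenerator n Q U) (hQ : IsHyperbolic n Q) (h : W ≤ U) :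
    U ≤ perp Q W :=
  (hU.perp_eq hQ).ge.trans (perp_anti h)

theorem IsGenerator.finrank_inf_perp_add (hU : IsGenerator n Q U) (hQ : IsHyperbolic n Q)
    (W : Submodule F V) :
    finrank F (U ⊓ perp Q W : Submodule F V) + finrank F W =
      n + finrank F (U ⊓ W : Submodule F V) := by
  have h_inf : U ⊓ perp Q W = perp Q (U ⊔ W) := by rw [perp_sup, hU.perp_eq hQ]
  have h_perp := hQ.finrank_perp_add (U ⊔ W)
  have h_sup := Submodule.finrank_sup_add_finrank_inf_eq U W
  rw [h_inf]
  rw [hU.2] at h_sup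
  omega

theorem Adjacent.mem_or_mem (h : Adjacent n U W) (hQ : IsHyperbolic n Q) (hU : IsGenerator n Q U)
    (hW : IsGenerator n Q W) {z : V} (hz : Q z = 0) (hz_perp : z ∈ perp Q (U ⊓ W)) :
    z ∈ U ∨ z ∈ W := by
  rw [hQ.perp_inf, hU.perp_eq hQ, hW.perp_eq hQ] at hz_perp
  obtain ⟨u, hu, w, hw, rfl⟩ := Submodule.mem_sup.1 hz_perp
  have huw : polar Q w u = 0 := by
    rw [QuadraticMap.map_add Q, hU.1 u hu, hW.1 w hw, zero_add, zero_add] at hz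
    rw [polar_comm, hz]
  by_cases hwU : w ∈ U
  · exact Or.inl (U.add_mem hu hwU)
  have h_span : U ⊓ W ⊔ F ∙ w = W := by
    refine Submodule.eq_of_le_of_finrank_eq (sup_le inf_le_right (by simpa using hw)) ?_
    have hwUW : w ∉ U ⊓ W := fun hw' => hwU hw'.1
    rw [Submodule.finrank_sup_span_singleton hwUW, hW.2, h]
  have huW : u ∈ perp Q W := by
    rw [← h_span, perp_sup]
    exact ⟨hU.le_perp_of_le hQ inf_le_left hu, mem_perp_span_singleton.2 huw⟩
  rw [hW.perp_eq hQ] at huW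
  exact Or.inr (W.add_mem huW hw)

theorem Adjacent.inf_perp_le_or_le (h : Adjacent n U W) (hQ : IsHyperbolic n Q)
    (hU : IsGenerator n Q U) (hW : IsGenerator n Q W) (hE : TotallySingular Q E) :
    E ⊓ perp Q (U ⊓ W) ≤ U ∨ E ⊓ perp Q (U ⊓ W) ≤ W :=
  AddSubgroupClass.subset_union.1 fun _ hz => h.mem_or_mem hQ hU hW (hE _ hz.1) hz.2

theorem Adjacent.finrank_inf_eq_add_one (h : Adjacent n U W) (hQ : IsHyperbolic n Q)
    (hU : IsGenerator n Q U) (hW : IsGenerator n Q W) (hE : IsGenerator n Q E)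
    (hEU : E ⊓ perp Q (U ⊓ W) ≤ U) :
    finrank F (U ⊓ E : Submodule F V) = finrank F (W ⊓ E : Submodule F V) + 1 := by
  have h_left : E ⊓ perp Q (U ⊓ W) = U ⊓ E :=
    le_antisymm (le_inf hEU inf_le_left)
      (le_inf inf_le_right (inf_le_left.trans (hU.le_perp_of_le hQ inf_le_left)))
  have h_right : E ⊓ (U ⊓ W) = W ⊓ E := by
    refine le_antisymm (le_inf (inf_le_right.trans inf_le_right) inf_le_left) ?_
    refine le_inf inf_le_right (le_inf (le_trans ?_ hEU) inf_le_left)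
    exact le_inf inf_le_right (inf_le_left.trans (hW.le_perp_of_le hQ inf_le_right))
  have h_finrank := hE.finrank_inf_perp_add hQ (U ⊓ W)
  rw [h_left, h_right] at h_finrank
  unfold Adjacent at h
  omega

theorem Adjacent.odd_finrank_inf_add (h : Adjacent n U W) (hQ : IsHyperbolic n Q)
    (hU : IsGenerator n Q U) (hW : IsGenerator n Q W) (hE : IsGenerator n Q E) :
    Odd (finrank F (U ⊓ E : Submodule F V) + finrank F (W ⊓ E : Submodule F V)) := by
  rcases h.inf_perp_le_or_le hQ hU hW hE.1 with hEU | hEW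
  · rw [h.finrank_inf_eq_add_one hQ hU hW hE hEU]
    exact ⟨_, by ring⟩
  · rw [h.symm.finrank_inf_eq_add_one hQ hW hU hE (by rwa [inf_comm W])]
    exact ⟨_, by ring⟩

theorem IsGenerator.finrank_inf_perp_span_singleton (hU : IsGenerator n Q U)
    (hQ : IsHyperbolic n Q) {x : V} (hx : x ∉ U) :
    finrank F (U ⊓ perp Q (F ∙ x) : Submodule F V) + 1 = n := by
  have hx_ne : x ≠ 0 := fun h => hx (h ▸ U.zero_mem)
  have h_bot : U ⊓ F ∙ x = ⊥ := disjoint_iff.1 ((Submodule.disjoint_span_singleton' hx_ne).2 hx)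
  have h_finrank := hU.finrank_inf_perp_add hQ (F ∙ x)
  rwa [finrank_span_singleton hx_ne, h_bot, finrank_bot] at h_finrank

theorem adjacent_of_le_inf (hU : IsGenerator n Q U) (hW : IsGenerator n Q W) (hne : U ≠ W)
    {H : Submodule F V} (hH : H ≤ U ⊓ W) (h_finrank : finrank F H + 1 = n) : Adjacent n U W := by
  have h_lt : U ⊓ W < U := inf_le_left.lt_of_ne fun h =>
    hne (Submodule.eq_of_le_of_finrank_eq (inf_eq_left.1 h) (hU.2.trans hW.2.symm))
  have h_upper := hU.2 ▸ Submodule.finrank_lt_finrank_of_lt h_lt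
  have h_lower := Submodule.finrank_mono hH
  unfold Adjacent
  omega

theorem exists_adjacent_inf_lt (hQ : IsHyperbolic n Q) (hU : IsGenerator n Q U)
    (hM : IsGenerator n Q M) (hne : U ≠ M) :
    ∃ W, IsGenerator n Q W ∧ Adjacent n U W ∧ U ⊓ M < W ⊓ M := by
  obtain ⟨m, hmM, hmU⟩ : ∃ m ∈ M, m ∉ U := SetLike.not_le_iff_exists.1 fun h =>
    hne (Submodule.eq_of_le_of_finrank_eq h (hM.2.trans hU.2.symm)).symm
  have h_finrank := hU.finrank_inf_perp_span_singleton hQ hmU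
  let W := U ⊓ perp Q (F ∙ m) ⊔ F ∙ m
  have hW : IsGenerator n Q W := by
    refine ⟨(hU.1.mono inf_le_left).sup (totallySingular_span_singleton (hM.1 m hmM))
      inf_le_right, ?_⟩
    have hm_notMem : m ∉ U ⊓ perp Q (F ∙ m) := fun h => hmU h.1
    rw [Submodule.finrank_sup_span_singleton hm_notMem, h_finrank]
  have hmW : m ∈ W := Submodule.mem_sup_right (Submodule.mem_span_singleton_self m)
  have hUM : U ⊓ M ≤ U ⊓ perp Q (F ∙ m) := le_inf inf_le_left fun x hx =>
    mem_perp_span_singleton.2 (hM.1.polar_eq_zero hmM hx.2)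
  refine ⟨W, hW, adjacent_of_le_inf hU hW (fun h => hmU (h ▸ hmW))
    (le_inf inf_le_left le_sup_left) h_finrank,
    (le_inf (hUM.trans le_sup_left) inf_le_right).lt_of_ne fun h => hmU (h.ge ⟨hmW, hmM⟩).1⟩

theorem even_finrank_inf_add {A B E : Submodule F V} (hQ : IsHyperbolic n Q)
    (hA : IsGenerator n Q A) (hB : IsGenerator n Q B) (hE : IsGenerator n Q E) :
    Even (n + finrank F (A ⊓ B : Submodule F V) + finrank F (A ⊓ E : Submodule F V) +
      finrank F (B ⊓ E : Submodule F V)) := by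
  by_cases hAB : A = B
  · rw [hAB, inf_idem, hB.2]
    exact ⟨n + finrank F (B ⊓ E : Submodule F V), by ring⟩
  obtain ⟨A', hA', h_adj, h_lt⟩ := exists_adjacent_inf_lt hQ hA hB hAB
  have h_ih := even_finrank_inf_add hQ hA' hB hE
  have h_oddB := h_adj.odd_finrank_inf_add hQ hA hA' hB
  have h_oddE := h_adj.odd_finrank_inf_add hQ hA hA' hE
  grind
termination_by n - finrank F (A ⊓ B : Submodule F V)
decreasing_by
  have := Submodule.finrank_lt_finrank_of_lt h_lt
  have := hA'.2 ▸ Submodule.finrank_mono (inf_le_left : A' ⊓ B ≤ A')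
  omega

end Generators

section Reflections

variable {F V : Type*} [Field F] [AddCommGroup V] [Module F V] {Q : QuadraticForm F V} {n : ℕ}

/-- The reflection `x ↦ x - (Q v)⁻¹ polar(x, v) v` in a nonsingular vector `v`. It is an isometry
in every characteristic; in characteristic two it is an orthogonal transvection. -/
noncomputable def reflection (Q : QuadraticForm F V) {v : V} (hv : Q v ≠ 0) : V ≃ₗ[F] V :=
  Module.reflection (x := v) (f := (Q v)⁻¹ • (polarBilin Q).flip v) <| by
    rw [LinearMap.smul_apply, LinearMap.flip_apply, polarBilin_apply_apply, polar_self, smul_comm,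
      smul_eq_mul, inv_mul_cancel₀ hv, nsmul_one, Nat.cast_ofNat]

theorem reflection_apply {v : V} (hv : Q v ≠ 0) (x : V) :
    reflection Q hv x = x - ((Q v)⁻¹ * polar Q x v) • v := rfl

theorem map_reflection {v : V} (hv : Q v ≠ 0) (x : V) : Q (reflection Q hv x) = Q x := by
  rw [reflection_apply, sub_eq_add_neg, QuadraticMap.map_add Q, QuadraticMap.map_neg,
    QuadraticMap.map_smul, polar_neg_right, polar_smul_right, smul_eq_mul, smul_eq_mul]
  field_simp
  ring

theorem exists_reflection_apply_eq {p p' : V} (hp : Q p = 0) (hp' : Q p' = 0)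
    (h : polar Q p p' ≠ 0) : ∃ (v : V) (hv : Q v ≠ 0), reflection Q hv p = p' := by
  have hv : Q (p - p') = -polar Q p p' := by
    rw [sub_eq_add_neg, QuadraticMap.map_add Q, QuadraticMap.map_neg, polar_neg_right, hp, hp',
      zero_add, zero_add]
  refine ⟨p - p', by rwa [hv, neg_ne_zero], ?_⟩
  rw [reflection_apply, hv, polar_sub_right, polar_self_eq_zero hp, zero_sub,
    inv_mul_cancel₀ (neg_ne_zero.2 h), one_smul, sub_sub_cancel]

section IsometricImages

variable {g : V ≃ₗ[F] V} (hg : ∀ x, Q (g x) = Q x)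
include hg

theorem totallySingular_map (U : Submodule F V) :
    TotallySingular Q (U.map (g : V →ₗ[F] V)) ↔ TotallySingular Q U := by
  refine ⟨fun h x hx => (hg x).symm.trans (h _ (Submodule.mem_map_of_mem hx)), ?_⟩
  rintro h _ ⟨x, hx, rfl⟩
  exact (hg x).trans (h x hx)

theorem isGenerator_map (U : Submodule F V) :
    IsGenerator n Q (U.map (g : V →ₗ[F] V)) ↔ IsGenerator n Q U := by
  rw [IsGenerator, IsGenerator, totallySingular_map hg, LinearEquiv.finrank_map_eq]

end IsometricImages

theorem IsGenerator.adjacent_map_reflection [FiniteDimensional F V] {U : Submodule F V}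
    (hU : IsGenerator n Q U) (hQ : IsHyperbolic n Q) {v : V} (hv : Q v ≠ 0) :
    Adjacent n U (U.map (reflection Q hv : V →ₗ[F] V)) := by
  have hvU : v ∉ U := fun h => hv (hU.1 v h)
  obtain ⟨u, hu, huv⟩ : ∃ u ∈ U, polar Q u v ≠ 0 := by
    by_contra! h
    exact hvU (hU.perp_eq hQ ▸ mem_perp.2 h)
  refine adjacent_of_le_inf hU ((isGenerator_map (map_reflection hv) U).2 hU) (fun h => ?_)
    (le_inf inf_le_left fun x hx => ?_) (hU.finrank_inf_perp_span_singleton hQ hvU)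
  · have h_mem : reflection Q hv u ∈ U := by
      rw [h]
      exact Submodule.mem_map_of_mem hu
    rw [reflection_apply, U.sub_mem_iff_right hu,
      U.smul_mem_iff (mul_ne_zero (inv_ne_zero hv) huv)] at h_mem
    exact hvU h_mem
  · refine ⟨x, hx.1, ?_⟩
    have hxv : polar Q x v = 0 := by rw [polar_comm, mem_perp_span_singleton.1 hx.2]
    rw [LinearEquiv.coe_coe, reflection_apply, hxv, mul_zero, zero_smul, sub_zero]

end Reflections

section Frame

variable {F V : Type*} [Field F] [AddCommGroup V] [Module F V] {Q : QuadraticForm F V} {n : ℕ}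
  {e : Fin n × ℤˣ → V}

theorem IsPolarFrame.linearIndependent (he : IsPolarFrame Q e) : LinearIndependent F e := by
  rw [Fintype.linearIndependent_iff]
  intro c hc a
  have h_polar : polarBilin Q (e (a.1, -a.2)) (∑ i, c i • e i) = 0 := by rw [hc, map_zero]
  rw [map_sum, Finset.sum_eq_single a (fun b _ hb => ?_) (by simp), map_smul, smul_eq_mul,
    mul_eq_zero] at h_polar
  · exact h_polar.resolve_right fun h => (he.2 _ _).1 h (by simp)
  · rw [map_smul, polarBilin_apply_apply, (he.2 _ _).2 (by simpa using hb), smul_zero]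

theorem IsPolarFrame.isGenerator (he : IsPolarFrame Q e) :
    IsGenerator n Q (frameSpace e .gen) := by
  refine ⟨totallySingular_span ?_ ?_, ?_⟩
  · rintro _ ⟨a, -, rfl⟩
    exact he.1 a
  · rintro _ ⟨⟨i, ε⟩, rfl : ε = 1, rfl⟩ _ ⟨⟨j, δ⟩, rfl : δ = 1, rfl⟩
    exact (he.2 _ _).2 (by simp)
  · have h_image : e '' {a | a.2 = 1} = Set.range fun i : Fin n => e (i, 1) := by
      ext x
      simp
    rw [frameSpace, h_image, finrank_span_eq_card, Fintype.card_fin]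
    exact he.linearIndependent.comp (fun i : Fin n => (i, (1 : ℤˣ))) (Prod.mk_left_injective 1)

theorem mem_isometryGroup {g : V ≃ₗ[F] V} (hg : ∀ x, Q (g x) = Q x)
    (h_class : ∀ U, IsGenerator n Q U →
      (finrank F (U.map (g : V →ₗ[F] V) ⊓ frameSpace e .gen : Submodule F V) ≡ n [MOD 2] ↔
        finrank F (U ⊓ frameSpace e .gen : Submodule F V) ≡ n [MOD 2])) :
    g ∈ isometryGroup Q e := by
  refine ⟨hg, fun j U => ?_⟩
  cases j with
  | sub i =>
    exact and_congr (totallySingular_map hg U) (by rw [LinearEquiv.finrank_map_eq])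
  | gen => exact (and_congr_left' (isGenerator_map hg U)).trans (and_congr_right (h_class U))
  | gen' =>
    exact (and_congr_left' (isGenerator_map hg U)).trans
      (and_congr_right fun hU => not_congr (h_class U hU))

variable [FiniteDimensional F V]

theorem reflection_mul_reflection_mem_isometryGroup (hQ : IsHyperbolic n Q)
    (he : IsPolarFrame Q e) {v w : V} (hv : Q v ≠ 0) (hw : Q w ≠ 0) :
    reflection Q hw * reflection Q hv ∈ isometryGroup Q e := by
  refine mem_isometryGroup (fun x => (map_reflection hw _).trans (map_reflection hv x))
    fun U hU => ?_
  have hU' := (isGenerator_map (map_reflection hv) U).2 hU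
  have hU'' := (isGenerator_map (map_reflection hw) _).2 hU'
  have h_odd := (hU.adjacent_map_reflection hQ hv).odd_finrank_inf_add hQ hU hU' he.isGenerator
  have h_odd' := (hU'.adjacent_map_reflection hQ hw).odd_finrank_inf_add hQ hU' hU'' he.isGenerator
  rw [← Submodule.map_comp] at h_odd'
  change Odd (_ + finrank F (U.map (reflection Q hw * reflection Q hv : V ≃ₗ[F] V).toLinearMap ⊓
    frameSpace e .gen : Submodule F V)) at h_odd'
  rw [Nat.odd_iff] at h_odd h_odd'
  rw [Nat.ModEq, Nat.ModEq]
  omega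

end Frame

section Transitivity

variable {F V : Type*} [Field F] [AddCommGroup V] [Module F V] {Q : QuadraticForm F V} {n : ℕ}

theorem exists_polar_ne_zero_and_ne_zero (hQ : IsHyperbolic n Q) {p p' : V} (hp : p ≠ 0)
    (hp' : p' ≠ 0) : ∃ z, polar Q p z ≠ 0 ∧ polar Q p' z ≠ 0 := by
  have h_proper : ∀ {x : V}, x ≠ 0 → ¬ ⊤ ≤ perp Q (F ∙ x) := fun hx h =>
    hx (hQ.2.1 _ fun z => mem_perp_span_singleton.1 (h (Submodule.mem_top (x := z))))
  by_contra! h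
  refine (AddSubgroupClass.subset_union.1 fun z _ => ?_).elim (h_proper hp) (h_proper hp')
  by_cases hz : polar Q p z = 0
  · exact Or.inl (mem_perp_span_singleton.2 hz)
  · exact Or.inr (mem_perp_span_singleton.2 (h z hz))

variable [FiniteDimensional F V]

theorem exists_nonsingular_mem_perp_pair (hn : 2 ≤ n) (hQ : IsHyperbolic n Q) {p p' : V}
    (hp : Q p = 0) (h : polar Q p p' ≠ 0) : ∃ z ∈ perp Q (Submodule.span F {p, p'}), Q z ≠ 0 := by
  by_contra! hW
  have hp_notMem : p ∉ perp Q (Submodule.span F {p, p'}) := fun hp_mem =>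
    h ((polar_comm Q p p').trans (mem_perp_span.1 hp_mem p' (by simp)))
  have h_sup : TotallySingular Q (perp Q (Submodule.span F {p, p'}) ⊔ F ∙ p) :=
    TotallySingular.sup hW (totallySingular_span_singleton hp)
      (perp_anti (Submodule.span_mono (by simp)))
  have h_le := h_sup.finrank_le hQ
  have h_perp := hQ.finrank_perp_add (Submodule.span F {p, p'})
  have h_pair : finrank F (Submodule.span F {p, p'}) ≤ 2 := by
    classical
    rw [← Finset.coe_pair]
    exact (finrank_span_finset_le_card _).trans Finset.card_le_two
  rw [Submodule.finrank_sup_span_singleton hp_notMem] at h_le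
  omega

theorem exists_singular_polar_ne_zero (hn : 2 ≤ n) (hQ : IsHyperbolic n Q) {p p' : V}
    (hp : Q p = 0) (hp' : Q p' = 0) (hp_ne : p ≠ 0) (hp'_ne : p' ≠ 0) :
    ∃ r, Q r = 0 ∧ polar Q p r ≠ 0 ∧ polar Q p' r ≠ 0 := by
  by_cases h : polar Q p p' = 0
  · obtain ⟨z, hpz, hp'z⟩ := exists_polar_ne_zero_and_ne_zero hQ hp_ne hp'_ne
    refine ⟨z + (-(Q z) / polar Q p z) • p, ?_, ?_, ?_⟩
    · rw [QuadraticMap.map_add Q, QuadraticMap.map_smul, hp, polar_smul_right, polar_comm Q z,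
        smul_eq_mul, smul_eq_mul, div_mul_cancel₀ _ hpz]
      ring
    · rwa [polar_add_right, polar_smul_right, polar_self_eq_zero hp, smul_zero, add_zero]
    · rwa [polar_add_right, polar_smul_right, polar_comm Q p' p, h, smul_zero, add_zero]
  · obtain ⟨z, hz_perp, hz⟩ := exists_nonsingular_mem_perp_pair hn hQ hp h
    have hpz := mem_perp_span.1 hz_perp p (by simp)
    have hp'z := mem_perp_span.1 hz_perp p' (by simp)
    refine ⟨p + (-(Q z) / polar Q p p') • p' + z, ?_, ?_, ?_⟩
    · rw [QuadraticMap.map_add Q, QuadraticMap.map_add Q, QuadraticMap.map_smul, hp, hp',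
        polar_smul_right, polar_add_left, polar_smul_left, hpz, hp'z, smul_eq_mul, smul_eq_mul,
        smul_eq_mul, div_mul_cancel₀ _ h]
      ring
    · rw [polar_add_right, polar_add_right, polar_smul_right, polar_self_eq_zero hp, hpz,
        smul_eq_mul, div_mul_cancel₀ _ h]
      simpa using hz
    · rwa [polar_add_right, polar_add_right, polar_smul_right, polar_self_eq_zero hp', hp'z,
        smul_zero, add_zero, add_zero, polar_comm Q p' p]

theorem exists_mem_isometryGroup_apply_eq {e : Fin n × ℤˣ → V} (hn : 2 ≤ n)
    (hQ : IsHyperbolic n Q) (he : IsPolarFrame Q e) {p p' : V} (hp : Q p = 0) (hp' : Q p' = 0)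
    (hp_ne : p ≠ 0) (hp'_ne : p' ≠ 0) : ∃ g ∈ isometryGroup Q e, g p = p' := by
  obtain ⟨r, hr, hpr, hp'r⟩ := exists_singular_polar_ne_zero hn hQ hp hp' hp_ne hp'_ne
  obtain ⟨v, hv, hvr⟩ := exists_reflection_apply_eq hp hr hpr
  obtain ⟨w, hw, hwp'⟩ := exists_reflection_apply_eq hr hp' (by rwa [polar_comm])
  exact ⟨_, reflection_mul_reflection_mem_isometryGroup hQ he hv hw,
    (congrArg (reflection Q hw) hvr).trans hwp'⟩

end Transitivity

namespace Flag

variable {F V : Type*} [Field F] [AddCommGroup V] [Module F V] {Q : QuadraticForm F V} {n : ℕ}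
  {e : Fin n × ℤˣ → V} {J : Set (Node n)}

/-- The action of the type-preserving isometries on flags. -/
def map (g : V ≃ₗ[F] V) (hg : g ∈ isometryGroup Q e) (x : Flag Q e J) : Flag Q e J where
  elt j hj := (x.elt j hj).map (g : V →ₗ[F] V)
  hasType j hj := (hg.2 j _).2 (x.hasType j hj)
  incident j hj k hk := (x.incident j hj k hk).imp (Submodule.map_mono ·) <|
    Or.imp (Submodule.map_mono ·) <| And.imp_right fun h => by
      rwa [← Submodule.map_inf _ g.injective, LinearEquiv.finrank_map_eq]

theorem map_injective (g : V ≃ₗ[F] V) (hg : g ∈ isometryGroup Q e) :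
    Function.Injective (map g hg : Flag Q e J → Flag Q e J) := fun _ _ h =>
  Flag.ext <| funext₂ fun j hj => Submodule.map_injective_of_injective g.injective
    (congrArg (fun z : Flag Q e J => z.elt j hj) h)

end Flag

section DoubleCounting

theorem sum_ncard_inter {X Y : Type*} [Fintype X] [Finite Y] (f : X → Set Y) {S : Set Y} {c : ℕ}
    (hc : ∀ y ∈ S, {x | y ∈ f x}.ncard = c) : ∑ x, (f x ∩ S).ncard = c * S.ncard := by
  classical
  have := Fintype.ofFinite Y
  have h_comm := Finset.sum_card_bipartiteAbove_eq_sum_card_bipartiteBelow (s := Finset.univ)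
    (t := S.toFinset) fun x y => y ∈ f x
  have h_above : ∀ x, (S.toFinset.bipartiteAbove (fun x y => y ∈ f x) x).card =
      (f x ∩ S).ncard := fun x => by
    rw [← Set.ncard_coe_finset, Finset.coe_bipartiteAbove]
    simp only [Set.mem_toFinset, Set.inter_comm (f x)]
    rfl
  have h_below : ∀ y ∈ S.toFinset,
      (Finset.univ.bipartiteBelow (fun x y => y ∈ f x) y).card = c := fun y hy => by
    rw [← hc y (Set.mem_toFinset.1 hy), ← Set.ncard_coe_finset, Finset.coe_bipartiteBelow]
    simp only [Finset.mem_univ, true_and]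
  rw [Finset.sum_congr rfl fun x _ => h_above x, Finset.sum_congr rfl h_below,
    Finset.sum_const, ← Set.ncard_eq_toFinset_card', smul_eq_mul] at h_comm
  rw [h_comm, mul_comm]

end DoubleCounting

section SingularVectors

variable {F V : Type*} [Field F] [AddCommGroup V] [Module F V] {Q : QuadraticForm F V} {n : ℕ}

theorem ncard_fiber [Finite F] [FiniteDimensional F V] {f : V →ₗ[F] F} (hf : f ≠ 0) (c : F) :
    {x | f x = c}.ncard = Nat.card F ^ (finrank F V - 1) := by
  have h_equiv := f.toAddMonoidHom.fiberEquivKerOfSurjective (LinearMap.surjective hf) c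
  have h_ker : Nat.card f.toAddMonoidHom.ker = Nat.card F ^ finrank F (LinearMap.ker f) :=
    Module.natCard_eq_pow_finrank (K := F) (V := LinearMap.ker f)
  rw [← Module.Dual.finrank_ker_add_one_of_ne_zero (f := f) hf, Nat.add_sub_cancel, ← h_ker,
    ← Nat.card_congr h_equiv]
  rfl

/-- The nonzero singular vectors of `Q`. -/
def singularVectors (Q : QuadraticForm F V) : Set V := {x | Q x = 0} \ {0}

variable [FiniteDimensional F V]

theorem ncard_submodule (U : Submodule F V) : (U : Set V).ncard = Nat.card F ^ finrank F U := by
  rw [← Nat.card_coe_set_eq]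
  exact Module.natCard_eq_pow_finrank (K := F) (V := U)

variable [Finite F]

theorem TotallySingular.ncard_inter_singularVectors {U : Submodule F V}
    (hU : TotallySingular Q U) :
    (((U : Set V) ∩ singularVectors Q).ncard : ℚ) = (Nat.card F : ℚ) ^ finrank F U - 1 := by
  have : Finite V := Module.finite_of_finite F
  have h_inter : (U : Set V) ∩ singularVectors Q = (U : Set V) \ {0} := by
    ext x
    exact ⟨fun h => ⟨h.1, h.2.2⟩, fun h => ⟨h.1, hU x h.1, h.2⟩⟩
  have h_card := Set.ncard_sdiff_singleton_add_one (s := (U : Set V)) U.zero_mem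
  rw [h_inter, eq_sub_iff_add_eq]
  exact_mod_cast h_card.trans (ncard_submodule U)

theorem IsGenerator.ncard_singular_translates {M : Submodule F V} (hM : IsGenerator n Q M)
    (hQ : IsHyperbolic n Q) {z : V} (hz : z ∉ M) :
    {m : M | Q (z + m) = 0}.ncard = Nat.card F ^ (n - 1) := by
  have h_functional : polarBilin Q z ∘ₗ M.subtype ≠ 0 := fun h =>
    hz <| hM.perp_eq hQ ▸ mem_perp.2 fun m hm => (polar_comm Q m z).trans
      (LinearMap.congr_fun h ⟨m, hm⟩)
  rw [← hM.2, ← ncard_fiber h_functional (-Q z)]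
  congr 1 with m
  rw [Set.mem_ofPred_eq, Set.mem_ofPred_eq, QuadraticMap.map_add Q, hM.1 _ m.2, add_zero,
    eq_neg_iff_add_eq_zero, add_comm]
  rfl

theorem IsHyperbolic.ncard_singular (hQ : IsHyperbolic n Q) :
    ({x | Q x = 0}.ncard : ℚ) =
      Nat.card F ^ n + Nat.card F ^ (n - 1) * (Nat.card F ^ n - 1) := by
  have : Finite V := Module.finite_of_finite F
  obtain ⟨M, hM : IsGenerator n Q M⟩ := hQ.2.2
  have := Fintype.ofFinite M
  let f : M → Set V := fun m => {z | Q (z + m) = 0}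
  have h_card : (M : Set V).ncard = Nat.card F ^ n := by rw [ncard_submodule, hM.2]
  have h_translate : ∀ m, (f m).ncard = {x | Q x = 0}.ncard := fun m =>
    Set.ncard_preimage_of_injective_subset_range (s := {x | Q x = 0}) (add_left_injective (m : V))
      fun x _ => ⟨x - m, sub_add_cancel x _⟩
  have h_in : ∑ m, (f m ∩ M).ncard = Nat.card F ^ n * Nat.card F ^ n := by
    rw [sum_ncard_inter f (c := Nat.card F ^ n), h_card]
    intro z hz
    have h_univ : {m : M | z ∈ f m} = Set.univ :=
      Set.eq_univ_of_forall fun m => hM.1 _ (M.add_mem hz m.2)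
    rw [h_univ, Set.ncard_univ]
    exact h_card
  have h_out : ∑ m, (f m ∩ (M : Set V)ᶜ).ncard =
      Nat.card F ^ (n - 1) * (M : Set V)ᶜ.ncard :=
    sum_ncard_inter f fun z hz => hM.ncard_singular_translates hQ hz
  have h_compl := Set.ncard_add_ncard_compl (M : Set V)
  have h_total : ∑ m, (f m).ncard = ∑ m, (f m ∩ M).ncard + ∑ m, (f m ∩ (M : Set V)ᶜ).ncard := by
    rw [← Finset.sum_add_distrib]
    refine Finset.sum_congr rfl fun m _ => ?_
    rw [← Set.sdiff_eq, Set.ncard_inter_add_ncard_sdiff_eq_ncard]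
  rw [Finset.sum_congr rfl fun m _ => h_translate m, Finset.sum_const, Finset.card_univ,
    ← Nat.card_eq_fintype_card, h_in, h_out, smul_eq_mul,
    show Nat.card M = Nat.card F ^ n from h_card] at h_total
  rw [h_card, Module.natCard_eq_pow_finrank (K := F) (V := V), hQ.1, two_mul, pow_add] at h_compl
  have hq : (Nat.card F : ℚ) ^ n ≠ 0 := pow_ne_zero _ (Nat.cast_ne_zero.2 Nat.card_pos.ne')
  refine mul_left_cancel₀ hq ?_
  have h_compl' := congrArg (Nat.cast : ℕ → ℚ) h_compl
  have h_total' := congrArg (Nat.cast : ℕ → ℚ) h_total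
  push_cast at h_compl' h_total'
  linear_combination (Nat.card F : ℚ) ^ (n - 1) * h_compl' + h_total'

theorem IsHyperbolic.ncard_singularVectors (hQ : IsHyperbolic n Q) :
    ((singularVectors Q).ncard : ℚ) =
      (Nat.card F ^ n - 1) * (1 + Nat.card F ^ (n - 1)) := by
  have : Finite V := Module.finite_of_finite F
  have h_card := Set.ncard_sdiff_singleton_add_one (s := {x | Q x = 0}) (QuadraticMap.map_zero Q)
  have h_card' := congrArg (Nat.cast : ℕ → ℚ) h_card
  rw [hQ.ncard_singular] at h_card'
  push_cast at h_card'
  rw [singularVectors]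
  linear_combination h_card'

end SingularVectors

section FlagCounting

instance (n : ℕ) : Finite (Node n) :=
  Finite.of_surjective (Sum.elim Node.sub fun b : Bool => if b then .gen else .gen') fun j => by
    cases j with
    | sub i => exact ⟨.inl i, rfl⟩
    | gen => exact ⟨.inr true, rfl⟩
    | gen' => exact ⟨.inr false, rfl⟩

variable {F V : Type*} [Field F] [AddCommGroup V] [Module F V] {Q : QuadraticForm F V} {n : ℕ}
  {e : Fin n × ℤˣ → V} {J : Set (Node n)}

instance [Finite V] : Finite (Flag Q e J) :=
  Finite.of_injective (fun x : Flag Q e J => x.elt) fun _ _ h => Flag.ext h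

theorem HasType.totallySingular {j : Node n} {U : Submodule F V} (h : HasType Q e j U) :
    TotallySingular Q U := by
  cases j with
  | sub i => exact h.1
  | gen => exact h.1.1
  | gen' => exact h.1.1

variable [FiniteDimensional F V]

theorem ncard_flags_through_le [Finite V] (hn : 2 ≤ n) (hQ : IsHyperbolic n Q)
    (he : IsPolarFrame Q e) {j : Node n} (hj : j ∈ J) {p p' : V} (hp : p ∈ singularVectors Q)
    (hp' : p' ∈ singularVectors Q) :
    {x : Flag Q e J | p ∈ x.elt j hj}.ncard ≤ {x : Flag Q e J | p' ∈ x.elt j hj}.ncard := by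
  obtain ⟨g, hg, rfl⟩ := exists_mem_isometryGroup_apply_eq hn hQ he hp.1 hp'.1 hp.2 hp'.2
  exact Set.ncard_le_ncard_of_injOn (Flag.map g hg) (fun x hx => Submodule.mem_map_of_mem hx)
    (Flag.map_injective g hg).injOn

variable [Finite F]

theorem sum_flag_finrank_inf [Fintype (Flag Q e J)] (hn : 2 ≤ n) (hQ : IsHyperbolic n Q)
    (he : IsPolarFrame Q e) {j : Node n} (hj : j ∈ J) {d : ℕ}
    (hd : ∀ x : Flag Q e J, finrank F (x.elt j hj) = d) {M : Submodule F V}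
    (hM : TotallySingular Q M) :
    ((Nat.card F : ℚ) ^ n - 1) * (1 + (Nat.card F : ℚ) ^ (n - 1)) *
        ∑ x : Flag Q e J, ((Nat.card F : ℚ) ^ finrank F (x.elt j hj ⊓ M : Submodule F V) - 1) =
      ((Nat.card F : ℚ) ^ finrank F M - 1) * ((Nat.card F : ℚ) ^ d - 1) *
        Nat.card (Flag Q e J) := by
  have : Finite V := Module.finite_of_finite F
  have h_sing : ∀ x : Flag Q e J, TotallySingular Q (x.elt j hj) := fun x =>
    (x.hasType j hj).totallySingular
  obtain ⟨c, hc⟩ : ∃ c, ∀ p ∈ singularVectors Q, {x : Flag Q e J | p ∈ x.elt j hj}.ncard = c := by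
    rcases (singularVectors Q).eq_empty_or_nonempty with h | ⟨p, hp⟩
    · exact ⟨0, by simp [h]⟩
    · exact ⟨_, fun p' hp' => le_antisymm (ncard_flags_through_le hn hQ he hj hp' hp)
        (ncard_flags_through_le hn hQ he hj hp hp')⟩
  let f : Flag Q e J → Set V := fun x => x.elt j hj
  have h_all := congrArg (Nat.cast : ℕ → ℚ) (sum_ncard_inter f hc)
  have h_inM := congrArg (Nat.cast : ℕ → ℚ)
    (sum_ncard_inter f (S := (M : Set V) ∩ singularVectors Q) fun p hp => hc p hp.2)
  have h_flag : ∀ x, ((f x ∩ singularVectors Q).ncard : ℚ) = (Nat.card F : ℚ) ^ d - 1 := fun x => by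
    rw [← hd x]
    exact (h_sing x).ncard_inter_singularVectors
  have h_flagM : ∀ x, ((f x ∩ ((M : Set V) ∩ singularVectors Q)).ncard : ℚ) =
      (Nat.card F : ℚ) ^ finrank F (x.elt j hj ⊓ M : Submodule F V) - 1 := fun x => by
    rw [← Set.inter_assoc]
    exact ((h_sing x).mono inf_le_left).ncard_inter_singularVectors
  simp only [Nat.cast_sum, Nat.cast_mul, h_flag, h_flagM, hQ.ncard_singularVectors,
    hM.ncard_inter_singularVectors, Finset.sum_const, Finset.card_univ, nsmul_eq_mul,
    ← Nat.card_eq_fintype_card] at h_all h_inM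
  rw [h_inM]
  linear_combination (-((Nat.card F : ℚ) ^ finrank F M - 1)) * h_all

open Classical in
theorem sum_ite_mem_eq_ncard_mul_add {X : Type*} [Fintype X] (C : Set X) (a b : ℚ) :
    ∑ x, (if x ∈ C then a else b) = C.ncard * (a - b) + Nat.card X * b := by
  have h_split : ∀ x, (if x ∈ C then a else b) = (if x ∈ C then a - b else 0) + b := fun x => by
    split_ifs <;> ring
  simp only [h_split, Finset.sum_add_distrib, ← Finset.sum_filter, Finset.sum_const,
    Set.ncard_eq_toFinset_card', Nat.card_eq_fintype_card, nsmul_eq_mul,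
    Set.filter_mem_univ_eq_toFinset, Finset.card_univ]

theorem meetsBound_of_finrank_inf (hn : 2 ≤ n) (hQ : IsHyperbolic n Q) (he : IsPolarFrame Q e)
    {j : Node n} (hj : j ∈ J) {d : ℕ} (hd : ∀ x : Flag Q e J, finrank F (x.elt j hj) = d)
    {M : Submodule F V} (hM : TotallySingular Q M) {C : Set (Flag Q e J)} {a b : ℕ} (hba : b < a)
    (ha : ∀ x ∈ C, finrank F (x.elt j hj ⊓ M : Submodule F V) = a)
    (hb : ∀ x ∉ C, finrank F (x.elt j hj ⊓ M : Submodule F V) = b)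
    (hab : ((Nat.card F : ℚ) ^ finrank F M - 1) * ((Nat.card F : ℚ) ^ d - 1) =
      ((Nat.card F : ℚ) ^ n - 1) * ((Nat.card F : ℚ) ^ a - (Nat.card F : ℚ) ^ b +
        (1 + (Nat.card F : ℚ) ^ (n - 1)) * ((Nat.card F : ℚ) ^ b - 1))) :
    MeetsBound C := by
  classical
  have : Finite V := Module.finite_of_finite F
  have := Fintype.ofFinite (Flag Q e J)
  have h_sum := sum_flag_finrank_inf hn hQ he hj hd hM
  have h_summand : ∀ x : Flag Q e J,
      (Nat.card F : ℚ) ^ finrank F (x.elt j hj ⊓ M : Submodule F V) - 1 =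
        if x ∈ C then (Nat.card F : ℚ) ^ a - 1 else (Nat.card F : ℚ) ^ b - 1 := fun x => by
    split_ifs with hx
    · rw [ha x hx]
    · rw [hb x hx]
  rw [Finset.sum_congr rfl fun x _ => h_summand x, sum_ite_mem_eq_ncard_mul_add, hab] at h_sum
  have hq : (1 : ℚ) < Nat.card F := by exact_mod_cast Finite.one_lt_card
  have h_coeff : ((Nat.card F : ℚ) ^ n - 1) * ((Nat.card F : ℚ) ^ a - (Nat.card F : ℚ) ^ b) ≠ 0 :=
    mul_ne_zero (sub_pos.2 (one_lt_pow₀ hq (by omega))).ne'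
      (sub_pos.2 (pow_lt_pow_right₀ hq hba)).ne'
  rw [MeetsBound, eq_div_iff (by positivity)]
  refine mul_left_cancel₀ h_coeff ?_
  linear_combination h_sum

end FlagCounting

section SignedPermutations

variable {n : ℕ} {a b : Fin n × ℤˣ} {v w : Equiv.Perm (Fin n × ℤˣ)}

/-- The permutation `i ↦ -i` of the indices. The signed permutations are those commuting with
it. -/
def opp : Equiv.Perm (Fin n × ℤˣ) := Equiv.prodCongr (Equiv.refl _) (Equiv.neg _)

theorem opp_apply (a : Fin n × ℤˣ) : opp a = (a.1, -a.2) := rfl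

theorem opp_opp (a : Fin n × ℤˣ) : opp (opp a) = a := by
  rw [opp_apply, opp_apply, neg_neg]

theorem opp_ne (a : Fin n × ℤˣ) : opp a ≠ a := fun h =>
  units_ne_neg_self a.2 (congrArg Prod.snd h).symm

theorem eq_or_eq_opp (h : a.1 = b.1) : a = b ∨ a = opp b := by
  have h_sign : a.2 = b.2 ∨ a.2 = -b.2 :=
    (Int.natAbs_eq_natAbs_iff.1 (by rw [Int.units_natAbs, Int.units_natAbs])).imp
      Units.ext Units.ext
  exact h_sign.imp (Prod.ext h) (Prod.ext h)

theorem apply_opp (hw : Commute opp w) (a : Fin n × ℤˣ) : w (opp a) = opp (w a) :=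
  (Equiv.congr_fun hw.eq a).symm

theorem apply_ne_opp_apply (hw : Commute opp w) (h : a ≠ opp b) : w a ≠ opp (w b) := by
  rw [← apply_opp hw]
  exact w.injective.ne h

theorem bijective_fst_apply (hw : Commute opp w) :
    Function.Bijective fun i : Fin n => (w (i, 1)).1 := by
  refine Finite.injective_iff_bijective.1 fun i j hij => ?_
  rcases eq_or_eq_opp hij with h | h
  · exact congrArg Prod.fst (w.injective h)
  · rw [← apply_opp hw] at h
    exact congrArg Prod.fst (w.injective h)

/-- The product of the signs of a signed permutation. -/
def signProd (w : Equiv.Perm (Fin n × ℤˣ)) : ℤˣ := ∏ i, (w (i, 1)).2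

theorem snd_apply (hw : Commute opp w) (a : Fin n × ℤˣ) : (w a).2 = (w (a.1, 1)).2 * a.2 := by
  rcases Int.units_eq_one_or a.2 with h | h
  · rw [h, mul_one, ← h]
  · rw [show a = opp (a.1, 1) from Prod.ext rfl h, apply_opp hw]
    exact (mul_neg_one _).symm

theorem signProd_mul (hv : Commute opp v) (hw : Commute opp w) :
    signProd (v * w) = signProd v * signProd w := by
  simp only [signProd, Equiv.Perm.mul_apply]
  rw [Finset.prod_congr rfl fun i _ => snd_apply hv (w (i, 1)), Finset.prod_mul_distrib,
    (bijective_fst_apply hw).prod_comp fun i => (v (i, 1)).2]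

end SignedPermutations

section RootReflections

variable {n : ℕ} {a b : Fin n × ℤˣ} {w : Equiv.Perm (Fin n × ℤˣ)}

/-- Half the sum of the positive roots, as a function of the indices: the root of the pair `(a, b)`
with `a ≠ b` and `a ≠ -b` is positive if `height b < height a`, and simple if the heights differ
by one. -/
def height (a : Fin n × ℤˣ) : ℤ := (a.2 : ℤ) * (n - 1 - a.1)

theorem height_opp (a : Fin n × ℤˣ) : height (opp a) = -height a := by
  simp [height, opp_apply]

theorem height_ne (h : a ≠ b) (h_opp : a ≠ opp b) : height a ≠ height b := fun h_height => by
  have h_index : (a.1 : ℕ) ≠ b.1 := fun h_eq => (eq_or_eq_opp (Fin.ext h_eq)).elim h h_opp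
  unfold height at h_height
  rcases Int.units_eq_one_or a.2 with ha | ha <;> rcases Int.units_eq_one_or b.2 with hb | hb <;>
    simp only [ha, hb, Units.val_one, Units.val_neg] at h_height <;> omega

theorem ne_opp_of_height_eq_add_one (h : height a = height b + 1) : a ≠ opp b := by
  rintro rfl
  rw [height_opp] at h
  omega

/-- The reflection in the root of the pair `(a, b)`. -/
def rootReflection (a b : Fin n × ℤˣ) : Equiv.Perm (Fin n × ℤˣ) :=
  Equiv.swap a b * Equiv.swap (opp a) (opp b)

theorem rootReflection_apply (h : a ≠ opp b) (x : Fin n × ℤˣ) : rootReflection a b x =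
    if x = a then b else if x = b then a else if x = opp a then opp b
      else if x = opp b then opp a else x := by
  rw [rootReflection, Equiv.Perm.mul_apply, Equiv.swap_apply_def, Equiv.swap_apply_def]
  grind [opp_opp, opp_ne]

theorem rootReflection_apply_left (h : a ≠ opp b) : rootReflection a b a = b := by
  rw [rootReflection_apply h, if_pos rfl]

theorem rootReflection_apply_right (h : a ≠ opp b) : rootReflection a b b = a := by
  rw [rootReflection_apply h]
  grind

theorem commute_swap_swap_opp (h : a ≠ opp b) :
    Commute (Equiv.swap a b) (Equiv.swap (opp a) (opp b)) := by
  rw [commute_iff_eq, Equiv.mul_swap_eq_swap_mul, Equiv.swap_apply_of_ne_of_ne (opp_ne a),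
    Equiv.swap_apply_of_ne_of_ne h.symm (opp_ne b)]
  rintro rfl
  exact h (opp_opp a).symm

theorem rootReflection_mul_self (h : a ≠ opp b) :
    rootReflection a b * rootReflection a b = 1 := by
  rw [rootReflection, (commute_swap_swap_opp h).symm.mul_mul_mul_comm, Equiv.swap_mul_self,
    Equiv.swap_mul_self, one_mul]

theorem rootReflection_comm (a b : Fin n × ℤˣ) : rootReflection a b = rootReflection b a := by
  rw [rootReflection, Equiv.swap_comm a, Equiv.swap_comm (opp a), ← rootReflection]

theorem rootReflection_opp_opp (h : a ≠ opp b) :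
    rootReflection (opp a) (opp b) = rootReflection a b := by
  rw [rootReflection, opp_opp, opp_opp, ← (commute_swap_swap_opp h).eq, rootReflection]

theorem rootReflection_apply_opp_right (h : a ≠ opp b) : rootReflection a b (opp b) = opp a := by
  rw [← rootReflection_opp_opp h, rootReflection_apply_right (opp.injective.ne h)]

theorem mul_rootReflection (hw : Commute opp w) (a b : Fin n × ℤˣ) :
    w * rootReflection a b = rootReflection (w a) (w b) * w := by
  rw [rootReflection, rootReflection, ← mul_assoc, Equiv.mul_swap_eq_swap_mul w, mul_assoc,
    Equiv.mul_swap_eq_swap_mul w, apply_opp hw, apply_opp hw, mul_assoc]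

theorem height_le_height_rootReflection_or (h : height a = height b + 1) (x : Fin n × ℤˣ) :
    height x ≤ height (rootReflection a b x) ∨
      height x = height (rootReflection a b x) + 1 ∧ (x = a ∨ x = opp b) := by
  rw [rootReflection_apply (ne_opp_of_height_eq_add_one h)]
  have ha := height_opp a
  have hb := height_opp b
  grind

theorem rootReflection_eq_of_height_lt (h : height a = height b + 1) {x y : Fin n × ℤˣ}
    (hxy : y ≠ opp x) (h_lt : height y < height x)
    (h_lt' : height (rootReflection a b x) < height (rootReflection a b y)) :
    rootReflection a b = rootReflection x y := by
  have hab := ne_opp_of_height_eq_add_one h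
  have h_invol : rootReflection a b (rootReflection a b y) = y :=
    Equiv.congr_fun (rootReflection_mul_self hab) y
  have hx := height_le_height_rootReflection_or h x
  have hy := height_le_height_rootReflection_or h (rootReflection a b y)
  rw [h_invol] at hy
  have hx' : x = a ∨ x = opp b := by grind
  have hy' : y = b ∨ y = opp a := by
    have h_image : rootReflection a b y = a ∨ rootReflection a b y = opp b := by grind
    rw [← h_invol]
    refine h_image.imp (fun h_eq => ?_) fun h_eq => ?_
    · rw [h_eq, rootReflection_apply_left hab]
    · rw [h_eq, rootReflection_apply_opp_right hab]
  rcases hx' with rfl | rfl <;> rcases hy' with rfl | rfl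
  · rfl
  · exact absurd rfl hxy
  · exact absurd (opp_opp _).symm hxy
  · rw [rootReflection_comm (opp b), rootReflection_opp_opp hab]

end RootReflections

section WeylGroup

variable {n : ℕ} {a b : Fin n × ℤˣ} {v w : Equiv.Perm (Fin n × ℤˣ)}

theorem commute_opp_rootReflection (h : a ≠ opp b) : Commute opp (rootReflection a b) := by
  rw [commute_iff_eq, mul_rootReflection (Commute.refl opp), rootReflection_opp_opp h]

theorem sGen_eq {i j : Fin n} (hij : (j : ℕ) = i + 1) :
    sGen n i = rootReflection (i, 1) (j, 1) := by
  have h_lt : (i : ℕ) + 1 < n := hij ▸ j.2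
  have h_succ : (⟨i + 1, h_lt⟩ : Fin n) = j := Fin.ext hij.symm
  have h_ne : i ≠ j := fun h => by rw [h] at hij; omega
  have h_ne_opp : ((i, 1) : Fin n × ℤˣ) ≠ opp (j, 1) := fun h => h_ne (congrArg Prod.fst h)
  rw [sGen, dif_pos h_lt, Fin.eta, h_succ]
  ext1 ⟨k, ε⟩
  rw [rootReflection_apply h_ne_opp, Equiv.prodCongr_apply, Prod.map_apply, Equiv.refl_apply,
    Equiv.swap_apply_def]
  rcases eq_or_ne k i with rfl | hi
  · rcases Int.units_eq_one_or ε with rfl | rfl <;> simp [opp_apply]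
  rcases eq_or_ne k j with rfl | hj
  · rcases Int.units_eq_one_or ε with rfl | rfl <;> simp [opp_apply, hi]
  · simp [opp_apply, hi, hj]

theorem tGen_eq {j : Fin n} (hj : (j : ℕ) + 1 = n) :
    tGen n = Equiv.swap (j, 1) (opp (j, 1)) := by
  have h_lt : n - 1 < n := Nat.sub_one_lt_of_lt j.2
  obtain rfl : j = ⟨n - 1, h_lt⟩ := Fin.ext (Nat.eq_sub_of_add_eq hj)
  rw [tGen, dif_pos (Nat.zero_lt_of_lt h_lt), opp_apply]

theorem commute_opp_tGen {j : Fin n} (hj : (j : ℕ) + 1 = n) : Commute opp (tGen n) := by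
  rw [tGen_eq hj, commute_iff_eq, Equiv.mul_swap_eq_swap_mul, opp_opp, Equiv.swap_comm]

theorem simpleReflection_gen {i j : Fin n} (hij : (j : ℕ) = i + 1) (hj : (j : ℕ) + 1 = n) :
    simpleReflection .gen = rootReflection (i, 1) (opp (j, 1)) := by
  have hi : n - 2 = i := by omega
  have h_ne : i ≠ j := fun h => by rw [h] at hij; omega
  rw [simpleReflection, hi, sGen_eq hij, mul_rootReflection (commute_opp_tGen hj), mul_assoc,
    tGen_eq hj, Equiv.swap_mul_self, mul_one, Equiv.swap_apply_left, Equiv.swap_apply_of_ne_of_ne]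
  · exact fun h => h_ne (congrArg Prod.fst h)
  · exact fun h => h_ne (congrArg Prod.fst h)

theorem exists_simpleReflection_eq_sGen {i : Fin n} (hi : (i : ℕ) + 1 < n) :
    ∃ k : Node n, simpleReflection k = sGen n i := by
  by_cases h : (i : ℕ) < n - 2
  · exact ⟨.sub ⟨i, h⟩, rfl⟩
  · exact ⟨.gen', by rw [simpleReflection, show n - 2 = i by omega]⟩

theorem height_eq_add_one {i j : Fin n} (hij : (j : ℕ) = i + 1) :
    height (i, 1) = height (j, 1) + 1 := by
  simp only [height, hij]
  push_cast
  ring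

theorem height_eq_height_opp_add_one {i j : Fin n} (hij : (j : ℕ) = i + 1)
    (hj : (j : ℕ) + 1 = n) : height (i, 1) = height (opp (j, 1)) + 1 := by
  rw [height_eq_add_one hij, height_opp, add_left_inj]
  simp only [height, Units.val_one]
  omega

theorem exists_simpleReflection_eq (hn : 2 ≤ n) (k : Node n) : ∃ a b : Fin n × ℤˣ,
    height a = height b + 1 ∧ simpleReflection k = rootReflection a b := by
  cases k with
  | sub i =>
    have h_succ : (⟨i + 1, by omega⟩ : Fin n).val = (⟨i, by omega⟩ : Fin n) + 1 := rfl
    exact ⟨_, _, height_eq_add_one h_succ, sGen_eq h_succ⟩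
  | gen =>
    have h_succ : (⟨n - 1, by omega⟩ : Fin n).val = (⟨n - 2, by omega⟩ : Fin n) + 1 := by grind
    have h_last : (⟨n - 1, by omega⟩ : Fin n).val + 1 = n := by grind
    exact ⟨_, _, height_eq_height_opp_add_one h_succ h_last, simpleReflection_gen h_succ h_last⟩
  | gen' =>
    have h_succ : (⟨n - 1, by omega⟩ : Fin n).val = (⟨n - 2, by omega⟩ : Fin n) + 1 := by grind
    exact ⟨_, _, height_eq_add_one h_succ, sGen_eq h_succ⟩

theorem commute_opp_simpleReflection (hn : 2 ≤ n) (k : Node n) :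
    Commute opp (simpleReflection k) := by
  obtain ⟨a, b, h_height, hk⟩ := exists_simpleReflection_eq hn k
  exact hk ▸ commute_opp_rootReflection (ne_opp_of_height_eq_add_one h_height)

theorem simpleReflection_mem_weylGroup (k : Node n) : simpleReflection k ∈ weylGroup n :=
  Subgroup.subset_closure ⟨k, rfl⟩

theorem commute_opp_of_mem_weylGroup (hn : 2 ≤ n) (hw : w ∈ weylGroup n) : Commute opp w := by
  have h_le : weylGroup n ≤ Subgroup.centralizer {opp} := by
    refine (Subgroup.closure_le _).2 ?_
    rintro _ ⟨k, rfl⟩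
    exact Subgroup.mem_centralizer_singleton_iff.2 (commute_opp_simpleReflection hn k).eq.symm
  exact (Subgroup.mem_centralizer_singleton_iff.1 (h_le hw)).symm

theorem signProd_sGen (k : ℕ) : signProd (sGen n k) = 1 := by
  refine Finset.prod_eq_one fun i _ => ?_
  rw [sGen]
  split_ifs <;> rfl

theorem commute_opp_sGen (k : ℕ) : Commute opp (sGen n k) := by
  refine Equiv.ext fun x => ?_
  rw [sGen]
  split_ifs <;> rfl

theorem signProd_simpleReflection (hn : 2 ≤ n) (k : Node n) :
    signProd (simpleReflection k) = 1 := by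
  cases k with
  | sub i => exact signProd_sGen i
  | gen =>
    have h_tGen : Commute opp (tGen n) := commute_opp_tGen (j := ⟨n - 1, by omega⟩) (by grind)
    have h_sGen : Commute opp (sGen n (n - 2)) := commute_opp_sGen _
    rw [simpleReflection, signProd_mul (h_tGen.mul_right h_sGen) h_tGen,
      signProd_mul h_tGen h_sGen, signProd_sGen, mul_one, Int.units_mul_self]
  | gen' => exact signProd_sGen _

theorem signProd_of_mem_weylGroup (hn : 2 ≤ n) (hw : w ∈ weylGroup n) : signProd w = 1 := by
  have h_one : signProd (1 : Equiv.Perm (Fin n × ℤˣ)) = 1 := by simp [signProd]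
  induction hw using Subgroup.closure_induction with
  | mem w hw =>
    obtain ⟨k, rfl⟩ := hw
    exact signProd_simpleReflection hn k
  | one => exact h_one
  | mul v w hv hw ihv ihw =>
    rw [signProd_mul (commute_opp_of_mem_weylGroup hn hv) (commute_opp_of_mem_weylGroup hn hw),
      ihv, ihw, one_mul]
  | inv w hw ih =>
    have hw' := commute_opp_of_mem_weylGroup hn hw
    rw [← h_one, ← inv_mul_cancel w, signProd_mul hw'.inv_right hw', ih, mul_one]

theorem prod_mem_weylGroup (l : List (Node n)) : (l.map simpleReflection).prod ∈ weylGroup n :=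
  list_prod_mem (by simp [simpleReflection_mem_weylGroup])

theorem exists_reduced_word (hw : w ∈ weylGroup n) :
    ∃ l : List (Node n), l.length = length w ∧ (l.map simpleReflection).prod = w := by
  have h_mem : w ∈ Submonoid.closure (Set.range (simpleReflection (n := n))) := by
    rw [← Subgroup.closure_toSubmonoid_of_finite]
    exact hw
  obtain ⟨l, hl, rfl⟩ := Submonoid.exists_list_of_mem_closure h_mem
  obtain ⟨l, rfl⟩ : l ∈ Set.range (List.map simpleReflection) := by
    rw [Set.range_list_map]
    exact hl
  exact Nat.sInf_mem (s := {k | ∃ l' : List (Node n), l'.length = k ∧ _}) ⟨_, l, rfl, rfl⟩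

/- Follow the images of `a` and `b` along the word: the letter which puts them in the wrong order
is the reflection in their pair, and omitting it multiplies the product by `rootReflection a b`. -/
theorem exists_shorter_word (hn : 2 ≤ n) (h : a ≠ opp b) (hab : height b < height a)
    (l : List (Node n))
    (hl : height ((l.map simpleReflection).prod a) < height ((l.map simpleReflection).prod b)) :
    ∃ l' : List (Node n), l'.length < l.length ∧
      (l'.map simpleReflection).prod = (l.map simpleReflection).prod * rootReflection a b := by
  induction l with
  | nil => exact absurd hl (not_lt.2 hab.le)
  | cons k l ih =>
    have hw := commute_opp_of_mem_weylGroup hn (prod_mem_weylGroup l)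
    rw [List.map_cons, List.prod_cons] at hl ⊢
    set w := (l.map simpleReflection).prod
    have h_ne : w a ≠ opp (w b) := apply_ne_opp_apply hw h
    rcases lt_or_gt_of_ne
      (height_ne (w.injective.ne fun h_eq => by simp [h_eq] at hab) h_ne) with h_lt | h_gt
    · obtain ⟨l', h_length, hl'⟩ := ih h_lt
      exact ⟨k :: l', by simpa using h_length,
        by rw [List.map_cons, List.prod_cons, hl', mul_assoc]⟩
    · obtain ⟨c, d, hcd, hk⟩ := exists_simpleReflection_eq hn k
      rw [hk] at hl ⊢
      refine ⟨l, by simp, ?_⟩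
      rw [rootReflection_eq_of_height_lt hcd (fun h_eq => h_ne (by rw [h_eq, opp_opp])) h_gt hl,
        ← mul_rootReflection hw, mul_assoc, rootReflection_mul_self h, mul_one]

theorem length_mul_rootReflection_lt (hn : 2 ≤ n) (hw : w ∈ weylGroup n) (h : a ≠ opp b)
    (hab : height b < height a) (h_lt : height (w a) < height (w b)) :
    length (w * rootReflection a b) < length w := by
  obtain ⟨l, hl, rfl⟩ := exists_reduced_word hw
  obtain ⟨l', h_length, hl'⟩ := exists_shorter_word hn h hab l h_lt
  have h_le : length _ ≤ l'.length := Nat.sInf_le ⟨l', rfl, hl'⟩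
  exact h_le.trans_lt (hl ▸ h_length)

theorem IsLongest.height_lt (hn : 2 ≤ n) (hw : IsLongest w) (hab : height a = height b + 1)
    {k : Node n} (hk : simpleReflection k = rootReflection a b) :
    height (w a) < height (w b) := by
  have h := ne_opp_of_height_eq_add_one hab
  have h_mem : w * rootReflection a b ∈ weylGroup n :=
    mul_mem hw.1 (hk ▸ simpleReflection_mem_weylGroup k)
  have h_opp := commute_opp_of_mem_weylGroup hn hw.1
  have h_ne : height (w a) ≠ height (w b) :=
    height_ne (w.injective.ne fun h_eq => by simp [h_eq] at hab) (apply_ne_opp_apply h_opp h)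
  refine h_ne.lt_or_gt.resolve_right fun h_gt => ?_
  have h_lt := length_mul_rootReflection_lt hn h_mem h (by omega) <| by
    rwa [Equiv.Perm.mul_apply, Equiv.Perm.mul_apply, rootReflection_apply_left h,
      rootReflection_apply_right h]
  rw [mul_assoc, rootReflection_mul_self h, mul_one] at h_lt
  exact (hw.2 _ h_mem).not_gt h_lt

theorem IsLongest.height_add_le (hn : 2 ≤ n) (hw : IsLongest w) {i j : Fin n} (hij : i ≤ j) :
    height (w (i, 1)) + (j - i) ≤ height (w (j, 1)) := by
  obtain ⟨j, hj⟩ := j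
  induction j, (show (i : ℕ) ≤ j from hij) using Nat.le_induction with
  | base => simp
  | succ j h_le ih =>
    have h_succ : (⟨j + 1, hj⟩ : Fin n).val = (⟨j, by omega⟩ : Fin n) + 1 := rfl
    obtain ⟨k, hk⟩ := exists_simpleReflection_eq_sGen (i := ⟨j, by omega⟩) hj
    have h_step := hw.height_lt hn (height_eq_add_one h_succ) (hk.trans (sGen_eq h_succ))
    have h_prev := ih (by omega) h_le
    push_cast at h_prev ⊢
    omega

theorem neg_le_height (a : Fin n × ℤˣ) : -(n - 1 : ℤ) ≤ height a := by
  rw [height]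
  rcases Int.units_eq_one_or a.2 with h | h <;> rw [h] <;> push_cast <;> omega

theorem eq_of_height_eq {i : Fin n} (hi : (i : ℕ) + 1 < n) (h : height a = -(n - 1 - i : ℤ)) :
    a = (i, -1) := by
  rw [height] at h
  rcases Int.units_eq_one_or a.2 with h_sign | h_sign <;> rw [h_sign] at h <;> push_cast at h
  · omega
  · exact Prod.ext (Fin.ext (show (a.1 : ℕ) = i by omega)) h_sign

/- The heights of `w 1, …, w (n - 1)` increase and are at most `-1`, so they are
`-(n - 1), …, -1`. -/
theorem IsLongest.apply_of_lt (hn : 2 ≤ n) (hw : IsLongest w) {i : Fin n}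
    (hi : (i : ℕ) + 1 < n) : w (i, 1) = (i, -1) := by
  let first : Fin n := ⟨0, by omega⟩
  let penult : Fin n := ⟨n - 2, by omega⟩
  let last : Fin n := ⟨n - 1, by omega⟩
  have h_succ : (last : ℕ) = penult + 1 := by grind
  have h_last : (last : ℕ) + 1 = n := by grind
  have h_lt_opp : height (w (penult, 1)) < height (w (opp (last, 1))) :=
    hw.height_lt hn (height_eq_height_opp_add_one h_succ h_last)
      (simpleReflection_gen h_succ h_last)
  rw [apply_opp (commute_opp_of_mem_weylGroup hn hw.1), height_opp] at h_lt_opp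
  have h_lower := hw.height_add_le hn (show first ≤ i from Nat.zero_le _)
  have h_upper := hw.height_add_le hn (show i ≤ penult from by grind)
  have h_step := hw.height_add_le hn (show penult ≤ last from by grind)
  have h_first := neg_le_height (w (first, 1))
  refine eq_of_height_eq hi ?_
  grind

theorem IsLongest.eq_opp_of_even (hn : 2 ≤ n) (h_even : Even n) (hw : IsLongest w) :
    w = opp := by
  have h_opp := commute_opp_of_mem_weylGroup hn hw.1
  let last : Fin n := ⟨n - 1, by omega⟩
  have h_lt {i : Fin n} (hi : i ≠ last) : w (i, 1) = (i, -1) :=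
    hw.apply_of_lt hn (by grind)
  have h_fst : (w (last, 1)).1 = last := by
    by_contra h_ne
    exact h_ne ((bijective_fst_apply h_opp).1 (congrArg Prod.fst (h_lt h_ne) :))
  have h_snd : (w (last, 1)).2 = -1 := by
    have h_prod := signProd_of_mem_weylGroup hn hw.1
    rw [signProd, ← Finset.mul_prod_erase _ _ (Finset.mem_univ last),
      Finset.prod_congr rfl fun i hi => congrArg Prod.snd (h_lt (Finset.ne_of_mem_erase hi)),
      Finset.prod_const, Finset.card_erase_of_mem (Finset.mem_univ _), Finset.card_univ,
      Fintype.card_fin, Odd.neg_one_pow (Nat.Even.sub_odd (by omega) h_even odd_one)] at h_prod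
    simpa using congrArg Neg.neg h_prod
  have h_pos (i : Fin n) : w (i, 1) = opp (i, 1) := by
    by_cases hi : i = last
    · subst hi
      exact Prod.ext h_fst h_snd
    · exact h_lt hi
  refine Equiv.ext fun a => ?_
  rcases eq_or_eq_opp (show a.1 = ((a.1, 1) : Fin n × ℤˣ).1 from rfl) with h | h
  · rw [h, h_pos]
  · rw [h, apply_opp h_opp, h_pos]

end WeylGroup

section Opposition

variable {F V : Type*} [Field F] [AddCommGroup V] [Module F V] {Q : QuadraticForm F V} {n : ℕ}
  {e : Fin n × ℤˣ → V} {J : Set (Node n)} {w₀ : Equiv.Perm (Fin n × ℤˣ)} {x y : Flag Q e J}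

/-- The flags `x` and `y` extend to opposite maximal flags. For `J = J ^ w₀` this is opposition of
flags of type `J`. -/
def ExtendToOpposite (w₀ : Equiv.Perm (Fin n × ℤˣ)) (x y : Flag Q e J) : Prop :=
  ∃ c d : Flag Q e Set.univ, Extends c x ∧ Extends d y ∧ relPos Q e w₀ c d

/-- No two flags in `C` extend to opposite maximal flags. For `J = J ^ w₀` this is `IsEKR`, which
holds for every `C` if `J ≠ J ^ w₀`. -/
def IsOppositionFree (w₀ : Equiv.Perm (Fin n × ℤˣ)) (C : Set (Flag Q e J)) : Prop :=
  ∀ x ∈ C, ∀ y ∈ C, ¬ ExtendToOpposite w₀ x y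

theorem IsOppositionFree.isEKR {C : Set (Flag Q e J)} (hC : IsOppositionFree w₀ C) :
    IsEKR w₀ C := fun x hx y hy h => hC x hx y hy h.2

theorem ExtendToOpposite.exists_isometry (h : ExtendToOpposite w₀ x y) :
    ∃ g : V ≃ₗ[F] V, (∀ z, Q (g z) = Q z) ∧
      (∀ j hj, x.elt j hj = (frameSpace e j).map (g : V →ₗ[F] V)) ∧
      ∀ j hj, y.elt j hj = (frameSpace (e ∘ w₀) j).map (g : V →ₗ[F] V) := by
  obtain ⟨c, d, hcx, hdy, g, hg, hc, hd⟩ := h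
  exact ⟨g, hg.1, fun j hj => (hcx j hj).symm.trans (hc j _),
    fun j hj => (hdy j hj).symm.trans (hd j _)⟩

theorem disjoint_frameSpace_opp (he : IsPolarFrame Q e) (j : Node n) :
    Disjoint (frameSpace (F := F) e j) (frameSpace (e ∘ opp) j) := by
  have h_span {S : Set (Fin n × ℤˣ)} (f : Fin n → ℤˣ) (hS : ∀ a ∈ S, a.2 = f a.1) :
      Disjoint (Submodule.span F (e '' S)) (Submodule.span F (e ∘ opp '' S)) := by
    rw [Set.image_comp]
    refine he.linearIndependent.disjoint_span_image (Set.disjoint_left.2 ?_)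
    rintro _ ha ⟨a, ha', rfl⟩
    exact opp_ne a (Prod.ext rfl ((hS _ ha).trans (hS _ ha').symm))
  cases j with
  | sub i => exact h_span (fun _ => 1) fun a ha => ha.2
  | gen => exact h_span (fun _ => 1) fun a ha => ha
  | gen' => exact h_span (fun i => if i.val + 1 = n then -1 else 1) fun a ha => ha

theorem ExtendToOpposite.disjoint (h : ExtendToOpposite w₀ x y) (hn : 2 ≤ n) (h_even : Even n)
    (he : IsPolarFrame Q e) (hw₀ : IsLongest w₀) {j : Node n} (hj : j ∈ J) :
    Disjoint (x.elt j hj) (y.elt j hj) := by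
  obtain ⟨g, -, hx, hy⟩ := h.exists_isometry
  rw [hx, hy, hw₀.eq_opp_of_even hn h_even]
  exact (Submodule.disjoint_map g.injective (disjoint_frameSpace_opp he j) :)

theorem ExtendToOpposite.exists_polar_ne_zero (h : ExtendToOpposite w₀ x y) (hn : 2 ≤ n)
    (he : IsPolarFrame Q e) (hw₀ : IsLongest w₀) {i : Fin (n - 2)} (hi : .sub i ∈ J) :
    ∃ a ∈ x.elt (.sub i) hi, ∃ b ∈ y.elt (.sub i) hi, polar Q a b ≠ 0 := by
  obtain ⟨g, hg, hx, hy⟩ := h.exists_isometry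
  let k : Fin n := ⟨i, by omega⟩
  have h_mem (f : Fin n × ℤˣ → V) : f (k, 1) ∈ frameSpace (F := F) f (.sub i) :=
    Submodule.subset_span ⟨(k, 1), ⟨le_rfl, rfl⟩, rfl⟩
  refine ⟨g (e (k, 1)), ?_, g (e (w₀ (k, 1))), ?_, ?_⟩
  · rw [hx]
    exact Submodule.mem_map_of_mem (h_mem e)
  · rw [hy]
    exact Submodule.mem_map_of_mem (h_mem (e ∘ w₀))
  · rw [polar, ← _root_.map_add, hg, hg, hg, hw₀.apply_of_lt hn (by grind), ← polar]
    exact fun h_zero => (he.2 _ _).1 h_zero rfl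

theorem isOppositionFree_setOf_le (hn : 2 ≤ n) (he : IsPolarFrame Q e) (hw₀ : IsLongest w₀)
    {i : Fin (n - 2)} (hi : .sub i ∈ J) {M : Submodule F V} (hM : TotallySingular Q M) :
    IsOppositionFree w₀ {x : Flag Q e J | x.elt (.sub i) hi ≤ M} := fun x hx y hy h => by
  obtain ⟨a, ha, b, hb, h_polar⟩ := h.exists_polar_ne_zero hn he hw₀ hi
  exact h_polar (hM.polar_eq_zero (hx ha) (hy hb))

theorem isOppositionFree_of_finrank_lt [FiniteDimensional F V] (hn : 2 ≤ n) (h_even : Even n)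
    (he : IsPolarFrame Q e) (hw₀ : IsLongest w₀) {j : Node n} (hj : j ∈ J) {M : Submodule F V}
    {C : Set (Flag Q e J)}
    (hC : ∀ x ∈ C, finrank F M < 2 * finrank F (x.elt j hj ⊓ M : Submodule F V)) :
    IsOppositionFree w₀ C := fun x hx y hy h => by
  have h_disjoint : Disjoint (x.elt j hj ⊓ M) (y.elt j hj ⊓ M) :=
    (h.disjoint hn h_even he hw₀ hj).mono inf_le_left inf_le_left
  have h_sup := Submodule.finrank_sup_add_finrank_inf_eq (x.elt j hj ⊓ M) (y.elt j hj ⊓ M)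
  rw [h_disjoint.eq_bot, finrank_bot] at h_sup
  have h_le : finrank F (x.elt j hj ⊓ M ⊔ y.elt j hj ⊓ M : Submodule F V) ≤ finrank F M :=
    Submodule.finrank_mono (sup_le inf_le_right inf_le_right)
  have := hC x hx
  have := hC y hy
  omega

end Opposition

section Cases

variable {F V : Type*} [Field F] [AddCommGroup V] [Module F V] {Q : QuadraticForm F V} {n : ℕ}
  {e : Fin n × ℤˣ → V} {J : Set (Node n)} {w₀ : Equiv.Perm (Fin n × ℤˣ)} {j k : Node n}
  {U P M : Submodule F V}

theorem HasType.isGenerator (hU : HasType Q e j U) (hj : j = .gen ∨ j = .gen') :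
    IsGenerator n Q U := by
  rcases hj with rfl | rfl
  · exact hU.1
  · exact hU.1

variable [FiniteDimensional F V]

theorem HasType.odd_finrank_inf (hQ : IsHyperbolic n Q) (he : IsPolarFrame Q e)
    (hjk : j = .gen ∧ k = .gen' ∨ j = .gen' ∧ k = .gen) (hU : HasType Q e j U)
    (hM : HasType Q e k M) : Odd (n + finrank F (U ⊓ M : Submodule F V)) := by
  rcases hjk with ⟨rfl, rfl⟩ | ⟨rfl, rfl⟩
  all_goals
    have h_even := even_finrank_inf_add hQ hU.1 hM.1 he.isGenerator
    have h_classU := hU.2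
    have h_classM := hM.2
    rw [Nat.even_iff] at h_even
    rw [Nat.ModEq] at h_classU h_classM
    rw [Nat.odd_iff]
    omega

theorem incident_iff_adjacent (hQ : IsHyperbolic n Q) (he : IsPolarFrame Q e)
    (hjk : j = .gen ∧ k = .gen' ∨ j = .gen' ∧ k = .gen) (hU : HasType Q e j U)
    (hM : HasType Q e k M) : Incident j k U M ↔ Adjacent n U M := by
  have h_odd := hU.odd_finrank_inf hQ he hjk hM
  have hU_gen := hU.isGenerator (hjk.imp And.left And.left)
  have hM_gen := hM.isGenerator (hjk.symm.imp And.right And.right)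
  have h_self : ¬ Odd (n + n) := Nat.not_odd_iff_even.2 (Even.add_self n)
  refine ⟨?_, fun h => .inr (.inr ⟨hjk, h⟩)⟩
  rintro (h_le | h_le | ⟨-, h⟩)
  · rw [inf_eq_left.2 h_le, hU_gen.2] at h_odd
    exact absurd h_odd h_self
  · rw [inf_eq_right.2 h_le, hM_gen.2] at h_odd
    exact absurd h_odd h_self
  · exact h

theorem finrank_inf_eq_zero (hP : finrank F P = 1) (h : ¬ P ≤ M) :
    finrank F (P ⊓ M : Submodule F V) = 0 := by
  have h_lt : P ⊓ M < P := inf_le_left.lt_of_ne fun h_eq => h (inf_eq_left.1 h_eq)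
  have := Submodule.finrank_lt_finrank_of_lt h_lt
  omega

theorem finrank_inf_eq_one_of_not_incident {Q : QuadraticForm F V} {e : Fin 4 × ℤˣ → V}
    {j k : Node 4} (hQ : IsHyperbolic 4 Q) (he : IsPolarFrame Q e)
    (hjk : j = .gen ∧ k = .gen' ∨ j = .gen' ∧ k = .gen) (hU : HasType Q e j U)
    (hM : HasType Q e k M) (h : ¬ Incident j k U M) :
    finrank F (U ⊓ M : Submodule F V) = 1 := by
  rw [incident_iff_adjacent hQ he hjk hU hM, Adjacent] at h
  have h_odd := hU.odd_finrank_inf hQ he hjk hM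
  have h_le : finrank F (U ⊓ M : Submodule F V) ≤ 4 :=
    (hU.isGenerator (hjk.imp And.left And.left)).2 ▸ Submodule.finrank_mono inf_le_left
  rw [Nat.odd_iff] at h_odd
  omega

theorem isOppositionFree_setOf_ge (hn : 2 ≤ n) (h_even : Even n) (he : IsPolarFrame Q e)
    (hw₀ : IsLongest w₀) (hj : j ∈ J) (hP : finrank F P = 1) :
    IsOppositionFree w₀ {x : Flag Q e J | P ≤ x.elt j hj} :=
  isOppositionFree_of_finrank_lt hn h_even he hw₀ hj (M := P) fun x hx => by
    rw [inf_eq_right.2 hx, hP]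
    exact one_lt_two

theorem isOppositionFree_setOf_incident (hn : 3 ≤ n) (h_even : Even n) (hQ : IsHyperbolic n Q)
    (he : IsPolarFrame Q e) (hw₀ : IsLongest w₀)
    (hjk : j = .gen ∧ k = .gen' ∨ j = .gen' ∧ k = .gen) (hj : j ∈ J) (hM : HasType Q e k M) :
    IsOppositionFree w₀ {x : Flag Q e J | Incident j k (x.elt j hj) M} :=
  isOppositionFree_of_finrank_lt (by omega) h_even he hw₀ hj (M := M) fun x hx => by
    have h_adj := (incident_iff_adjacent hQ he hjk (x.hasType j hj) hM).1 hx
    rw [Adjacent] at h_adj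
    rw [(hM.isGenerator (hjk.symm.imp And.right And.right)).2]
    omega

variable [Finite F]

theorem meetsBound_setOf_point_le (hn : 2 ≤ n) (hQ : IsHyperbolic n Q) (he : IsPolarFrame Q e)
    {i : Fin (n - 2)} (hi : i.val = 0) (hiJ : .sub i ∈ J) (hM : IsGenerator n Q M) :
    MeetsBound {x : Flag Q e J | x.elt (.sub i) hiJ ≤ M} := by
  have h_point (x : Flag Q e J) : finrank F (x.elt (.sub i) hiJ) = 1 := by
    rw [(x.hasType _ hiJ).2, hi]
  refine meetsBound_of_finrank_inf hn hQ he hiJ h_point hM.1 zero_lt_one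
    (fun x hx => ?_) (fun x hx => finrank_inf_eq_zero (h_point x) hx) ?_
  · rw [inf_eq_left.2 hx, h_point]
  · rw [hM.2]
    ring

theorem meetsBound_setOf_ge (hn : 2 ≤ n) (hQ : IsHyperbolic n Q)
    (he : IsPolarFrame Q e) (hj : j = .gen ∨ j = .gen') (hjJ : j ∈ J) (hP : IsPoint Q P) :
    MeetsBound {x : Flag Q e J | P ≤ x.elt j hjJ} := by
  refine meetsBound_of_finrank_inf hn hQ he hjJ (fun x => ((x.hasType j hjJ).isGenerator hj).2)
    hP.1 zero_lt_one (fun x hx => ?_) (fun x hx => ?_) ?_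
  · rw [inf_eq_right.2 hx, hP.2]
  · rw [inf_comm, finrank_inf_eq_zero hP.2 hx]
  · rw [hP.2]
    ring

theorem meetsBound_setOf_incident {Q : QuadraticForm F V} {e : Fin 4 × ℤˣ → V}
    {J : Set (Node 4)} {j k : Node 4} (hQ : IsHyperbolic 4 Q) (he : IsPolarFrame Q e)
    (hjk : j = .gen ∧ k = .gen' ∨ j = .gen' ∧ k = .gen) (hjJ : j ∈ J) (hM : HasType Q e k M) :
    MeetsBound {x : Flag Q e J | Incident j k (x.elt j hjJ) M} := by
  have hM_gen := hM.isGenerator (hjk.symm.imp And.right And.right)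
  refine meetsBound_of_finrank_inf (a := 3) (b := 1) (by omega) hQ he hjJ
    (fun x => ((x.hasType j hjJ).isGenerator (hjk.imp And.left And.left)).2) hM_gen.1 (by omega)
    (fun x hx => ?_)
    (fun x hx => finrank_inf_eq_one_of_not_incident hQ he hjk (x.hasType j hjJ) hM hx) ?_
  · exact Nat.succ_injective ((incident_iff_adjacent hQ he hjk (x.hasType j hjJ) hM).1 hx)
  · rw [hM_gen.2]
    ring

end Cases

end Oriflamme

open Oriflamme in
theorem mainTheorem10_general {F V : Type*} [Field F] [Finite F] [AddCommGroup V] [Module F V]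
    (n : ℕ) (hn : 2 ≤ n) (Q : QuadraticForm F V) (hQ : IsHyperbolic n Q)
    (e : Fin n × ℤˣ → V) (he : IsPolarFrame Q e)
    (w₀ : Equiv.Perm (Fin n × ℤˣ)) (hw₀ : IsLongest w₀) (J : Set (Node n)) :
    (∀ i : Fin (n - 2), i.val = 0 → ∀ (hi : .sub i ∈ J) (M : Submodule F V), IsGenerator n Q M →
      IsOppositionFree w₀ {x : Flag Q e J | x.elt _ hi ≤ M} ∧
      MeetsBound {x : Flag Q e J | x.elt _ hi ≤ M}) ∧
    (Even n → ∀ j : Node n, (j = .gen ∨ j = .gen') →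
      ∀ (hj : j ∈ J) (P : Submodule F V), IsPoint Q P →
      IsOppositionFree w₀ {x : Flag Q e J | P ≤ x.elt j hj} ∧
      MeetsBound {x : Flag Q e J | P ≤ x.elt j hj}) ∧
    (n = 4 → ∀ j k : Node n, (j = .gen ∧ k = .gen' ∨ j = .gen' ∧ k = .gen) →
      ∀ (hj : j ∈ J) (M : Submodule F V), HasType Q e k M →
      IsOppositionFree w₀ {x : Flag Q e J | Incident j k (x.elt j hj) M} ∧
      MeetsBound {x : Flag Q e J | Incident j k (x.elt j hj) M}) := by
  have : FiniteDimensional F V := hQ.finiteDimensional (by omega)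
  refine ⟨fun i hi hiJ M hM => ⟨isOppositionFree_setOf_le hn he hw₀ hiJ hM.1,
      meetsBound_setOf_point_le hn hQ he hi hiJ hM⟩,
    fun h_even j hj hjJ P hP => ⟨isOppositionFree_setOf_ge hn h_even he hw₀ hjJ hP.2,
      meetsBound_setOf_ge hn hQ he hj hjJ hP⟩, ?_⟩
  rintro rfl j k hjk hjJ M hM
  exact ⟨isOppositionFree_setOf_incident (by omega) (by decide) hQ he hw₀ hjk hjJ hM,
    meetsBound_setOf_incident hQ he hjk hjJ hM⟩

theorem mainTheorem10 {F V : Type*} [Field F] [Finite F] [AddCommGroup V] [Module F V]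
    (n : ℕ) (hn : 4 ≤ n)
    (Q : QuadraticForm F V) (hQ : Oriflamme.IsHyperbolic n Q)
    (e : Fin n × ℤˣ → V) (he : Oriflamme.IsPolarFrame Q e)
    (w₀ : Equiv.Perm (Fin n × ℤˣ)) (hw₀ : Oriflamme.IsLongest w₀)
    (J : Set (Oriflamme.Node n)) (hJ : Oriflamme.ConjType w₀ J J) :
    -- (i) flags whose point lies in a fixed generator
    (∀ (h1 : Oriflamme.pointNode n hn ∈ J) (M : Submodule F V), Oriflamme.IsGenerator n Q M →
      Oriflamme.IsEKR w₀ {x : Oriflamme.Flag Q e J | x.elt _ h1 ≤ M} ∧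
      Oriflamme.MeetsBound {x : Oriflamme.Flag Q e J | x.elt _ h1 ≤ M}) ∧
    -- (ii) flags whose subspace of type n (resp. n') passes through a fixed point, n even
    (Even n → ∀ j : Oriflamme.Node n, (j = .gen ∨ j = .gen') →
      ∀ (hj : j ∈ J) (P : Submodule F V), Oriflamme.IsPoint Q P →
      Oriflamme.IsEKR w₀ {x : Oriflamme.Flag Q e J | P ≤ x.elt j hj} ∧
      Oriflamme.MeetsBound {x : Oriflamme.Flag Q e J | P ≤ x.elt j hj}) ∧
    -- (iii) flags whose subspace of type n (resp. n') is incident with a fixed one of type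
    -- n' (resp. n), for n = 4
    (n = 4 → ∀ j k : Oriflamme.Node n, (j = .gen ∧ k = .gen' ∨ j = .gen' ∧ k = .gen) →
      ∀ (hj : j ∈ J) (M : Submodule F V), Oriflamme.HasType Q e k M →
      Oriflamme.IsEKR w₀ {x : Oriflamme.Flag Q e J | Oriflamme.Incident j k (x.elt j hj) M} ∧
      Oriflamme.MeetsBound
        {x : Oriflamme.Flag Q e J | Oriflamme.Incident j k (x.elt j hj) M}) := by
  obtain ⟨h_point, h_generator, h_incident⟩ :=
    mainTheorem10_general n (by omega) Q hQ e he w₀ hw₀ J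
  exact ⟨fun h1 M hM => (h_point _ rfl h1 M hM).imp_left (·.isEKR),
    fun h_even j hj hjJ P hP => (h_generator h_even j hj hjJ P hP).imp_left (·.isEKR),
    fun h4 j k hjk hjJ M hM => (h_incident h4 j k hjk hjJ M hM).imp_left (·.isEKR)⟩
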